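/- Let $d\ge 1$ be an integer and let $\mathcal A$ be an abelian category. Subcategories are full and closed under isomorphisms and finite direct sums (in particular they contain $0$). An extension-closed subcategory $\mathcal E$ of $\mathcal A$ carries the induced exact structure: its conflations are the short exact sequences of $\mathcal A$ with all terms in $\mathcal E$; exact sequences in $\mathcal E$ are those obtained by splicing conflations, and $\operatorname{Ext}^i_{\mathcal E}(X,Y)$ denotes the $i$th Yoneda Ext-group of $\mathcal E$. A subcategory $\mathcal M\subseteq\mathcal E$ is $d$-cluster tilting in $\mathcal E$ if every $E\in\mathcal E$ admits a deflation $M\to E$ and an inflation $E\to M'$ in $\mathcal E$ with $M,M'\in\mathcal M$, if $\mathcal M$ is functorially finite in $\mathcal E$, and if $$\mathcal M=\{E\in\mathcal E\mid \operatorname{Ext}^i_{\mathcal E}(E,\mathcal M)=0\ \text{for all}\ 0<i<d\}=\{E\in\mathcal E\mid \operatorname{Ext}^i_{\mathcal E}(\mathcal M,E)=0\ \text{for all}\ 0<i<d\}.$$ Let $\mathcal M$ be a $d$-cluster tilting subcategory of $\mathcal A$, and let $\mathcal U\subseteq\mathcal M$ be a $d$-torsion class of $\mathcal M$, that is, a subcategory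 such that 1. $\mathcal U$ is closed under direct summands; 2. $\mathcal U$ is closed under $d$-extensions: every exact sequence $0\to U\to E_1\to\cdots\to E_d\to U'\to 0$ in $\mathcal A$ with $U,U'\in\mathcal U$ is Yoneda equivalent to an exact sequence $0\to U\to U_1\to\cdots\to U_d\to U'\to 0$ with all $U_i\in\mathcal U$; 3. $\mathcal U$ is closed under $d$-quotients: for every morphism $X\to U$ with $X\in\mathcal M$ and $U\in\mathcal U$ there is a complex $X\to U\to U^1\to\cdots\to U^d$ with all $U^i\in\mathcal U$ such that $0\to\operatorname{Hom}(U^d,T)\to\cdots\to\operatorname{Hom}(U^1,T)\to\operatorname{Hom}(U,T)\to\operatorname{Hom}(X,T)$ is exact for all $T\in\mathcal M$. Then the subcategory $$\mathcal U_d(\mathcal A)=\{A\in\mathcal A\mid \exists\ 0\to U_d\to\cdots\to U_1\to A\to 0\ \text{exact with}\ U_i\in\mathcal U\ \text{for}\ 1\le i\le d\}$$ is closed under extensions in $\mathcal A$, and $\mathcal U$ is a $d$-cluster tilting subcategory of the exact category $\mathcal U_d(\mathcal A)$. -/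

import Mathlib

open CategoryTheory CategoryTheory.Limits

universe v u

namespace HigherTorsion

variable {A : Type u} [Category.{v} A] [Abelian A]

/-! Full subcategories of an abelian category `A` are given by their objects (`ObjectProperty A`).
An extension-closed full subcategory `E` is an exact category with the induced exact structure:
its conflations are the short exact sequences of `A` all of whose terms lie in `E`. All notions
below are those of this exact category `E`; for `E = ⊤` it is `A` with all short exact
sequences. -/

/-- The conflations of the exact category `E`. -/
def Conflation (E : ObjectProperty A) (S : ShortComplex A) : Prop :=
  S.ShortExact ∧ E S.X₁ ∧ E S.X₂ ∧ E S.X₃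

/-- Deflations of `E`: the cokernel parts of conflations. -/
def IsDeflation (E : ObjectProperty A) {X Y : A} (p : X ⟶ Y) : Prop :=
  ∃ (K : A) (i : K ⟶ X) (w : i ≫ p = 0), Conflation E (ShortComplex.mk i p w)

/-- Inflations of `E`: the kernel parts of conflations. -/
def IsInflation (E : ObjectProperty A) {X Y : A} (i : X ⟶ Y) : Prop :=
  ∃ (Q : A) (p : Y ⟶ Q) (w : i ≫ p = 0), Conflation E (ShortComplex.mk i p w)

/-- The complex `⋯ ⟶ K₂ ⟶ K₁ ⟶ K₀ ⟶ 0` is exact (acyclic) in `E`: there are conflations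
`0 ⟶ Z (i+1) ⟶ K (i+1) ⟶ Z i ⟶ 0` such that each differential `K (i+1) ⟶ K i` is the composite
`K (i+1) ⟶ Z i ⟶ K i`, and `Z 0 ⟶ K 0` is an isomorphism
(that is, the conflation in degree `0` is `0 ⟶ Z 0 ⟶ K 0 ⟶ 0 ⟶ 0`). -/
def IsAcyclic (E : ObjectProperty A) (K : ChainComplex A ℕ) : Prop :=
  ∃ (Z : ℕ → A) (j : ∀ i, Z i ⟶ K.X i) (p : ∀ i, K.X (i + 1) ⟶ Z i)
    (w : ∀ i, j (i + 1) ≫ p i = 0),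
    IsIso (j 0) ∧ (∀ i, K.d (i + 1) i = p i ≫ j i) ∧
      ∀ i, Conflation E (ShortComplex.mk (j (i + 1)) (p i) (w i))

/-- An exact sequence `0 ⟶ Y ⟶ Eₙ ⟶ ⋯ ⟶ E₁ ⟶ X ⟶ 0` in `E` with `n` middle terms. It is
written as a chain complex with `X` in degree `0`, `Eᵢ` in degree `i` and `Y` in degree `n + 1`. -/
structure NExtension (E : ObjectProperty A) (n : ℕ) (X Y : A) where
  /-- the underlying complex -/
  K : ChainComplex A ℕ
  /-- the right end -/
  right : K.X 0 ≅ X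
  /-- the left end -/
  left : K.X (n + 1) ≅ Y
  isZero : ∀ i, n + 1 < i → IsZero (K.X i)
  acyclic : IsAcyclic E K

/-- There is a morphism of exact sequences which is the identity on both ends. -/
def NExtension.MapsTo {E : ObjectProperty A} {n : ℕ} {X Y : A} (ξ ζ : NExtension E n X Y) : Prop :=
  ∃ φ : ξ.K ⟶ ζ.K,
    φ.f 0 ≫ ζ.right.hom = ξ.right.hom ∧ φ.f (n + 1) ≫ ζ.left.hom = ξ.left.hom

/-- Yoneda equivalence of exact sequences in `E` with the same ends: both receive a morphism,
identical on the ends, from a third exact sequence in `E`. -/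
def NExtension.YonedaEquiv {E : ObjectProperty A} {n : ℕ} {X Y : A}
    (ξ ζ : NExtension E n X Y) : Prop :=
  ∃ η : NExtension E n X Y, η.MapsTo ξ ∧ η.MapsTo ζ

/-- The Yoneda extensions `Extⁿ_E(X, Y)` for `n > 0`, as a set: equivalence classes of exact
sequences `0 ⟶ Y ⟶ Eₙ ⟶ ⋯ ⟶ E₁ ⟶ X ⟶ 0` in `E`. -/
def YonedaExt (E : ObjectProperty A) (n : ℕ) (X Y : A) : Type (max u v) :=
  Quot (NExtension.YonedaEquiv (E := E) (n := n) (X := X) (Y := Y))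

/-- `Extⁿ_E(X, Y) = 0`. A group is zero if and only if it has at most one element. -/
def ExtVanishes (E : ObjectProperty A) (n : ℕ) (X Y : A) : Prop :=
  Subsingleton (YonedaExt E n X Y)

/-- `f : N ⟶ X` is a right `M`-approximation of `X`. -/
def IsRightApproximation (M : ObjectProperty A) {N X : A} (f : N ⟶ X) : Prop :=
  M N ∧ ∀ (N' : A) (g : N' ⟶ X), M N' → ∃ h : N' ⟶ N, h ≫ f = g

/-- `f : X ⟶ N` is a left `M`-approximation of `X`. -/
def IsLeftApproximation (M : ObjectProperty A) {X N : A} (f : X ⟶ N) : Prop :=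
  M N ∧ ∀ (N' : A) (g : X ⟶ N'), M N' → ∃ h : N ⟶ N', f ≫ h = g

/-- `M` is a `d`-cluster tilting subcategory of the exact category `E`. -/
structure IsClusterTilting (d : ℕ) (E M : ObjectProperty A) : Prop where
  le : M ≤ E
  generating : ∀ X, E X → ∃ (N : A) (p : N ⟶ X), M N ∧ IsDeflation E p
  cogenerating : ∀ X, E X → ∃ (N : A) (i : X ⟶ N), M N ∧ IsInflation E i
  contravariantlyFinite : ∀ X, E X → ∃ (N : A) (f : N ⟶ X), IsRightApproximation M f
  covariantlyFinite : ∀ X, E X → ∃ (N : A) (f : X ⟶ N), IsLeftApproximation M f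
  mem_iff_left : ∀ X, M X ↔
    E X ∧ ∀ i, 0 < i → i < d → ∀ N, M N → ExtVanishes E i X N
  mem_iff_right : ∀ X, M X ↔
    E X ∧ ∀ i, 0 < i → i < d → ∀ N, M N → ExtVanishes E i N X

/-- `U` is closed under `d`-extensions in `E`: every exact sequence
`0 ⟶ Y ⟶ E_d ⟶ ⋯ ⟶ E₁ ⟶ X ⟶ 0` in `E` with `X, Y ∈ U` is Yoneda equivalent in `E` to one with all
middle terms in `U`. -/
def IsClosedUnderDExtensions (d : ℕ) (E U : ObjectProperty A) : Prop :=
  ∀ (X Y : A), U X → U Y → ∀ ξ : NExtension E d X Y,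
    ∃ ζ : NExtension E d X Y, (∀ i, 1 ≤ i → i ≤ d → U (ζ.K.X i)) ∧ ξ.YonedaEquiv ζ

/-- The part `K (d+1) ⟶ K d ⟶ ⋯ ⟶ K 0` of the complex `K` is a right `d`-exact sequence in `M`:
its terms lie in `M`, and for all `T ∈ M` the sequence
`0 ⟶ Hom(K 0, T) ⟶ ⋯ ⟶ Hom(K d, T) ⟶ Hom(K (d+1), T)` is exact. -/
def IsRightDExact (d : ℕ) (M : ObjectProperty A) (K : ChainComplex A ℕ) : Prop :=
  (∀ i, i ≤ d + 1 → M (K.X i)) ∧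
  ∀ T, M T →
    (∀ g : K.X 0 ⟶ T, K.d 1 0 ≫ g = 0 → g = 0) ∧
    ∀ i, i < d → ∀ g : K.X (i + 1) ⟶ T, K.d (i + 2) (i + 1) ≫ g = 0 →
      ∃ h : K.X i ⟶ T, K.d (i + 1) i ≫ h = g

/-- `U` is closed under `d`-quotients in `M`: every `f : X ⟶ Y` with `X ∈ M` and `Y ∈ U` has a
`d`-cokernel `Y ⟶ U¹ ⟶ ⋯ ⟶ U^d ⟶ 0` in `M` with `Uⁱ ∈ U` for all `i`. Here `X` and `Y` are in
degrees `d + 1` and `d`, and `Uⁱ` is in degree `d - i`. -/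
def IsClosedUnderDQuotients (d : ℕ) (M U : ObjectProperty A) : Prop :=
  ∀ (X Y : A) (f : X ⟶ Y), M X → U Y →
    ∃ K : ChainComplex A ℕ, IsRightDExact d M K ∧
      Nonempty (Arrow.mk (K.d (d + 1) d) ≅ Arrow.mk f) ∧ ∀ i, i < d → U (K.X i)

/-- `U` is a `d`-torsion class of the `d`-cluster tilting subcategory `M` of `A`. -/
structure IsTorsionClass (d : ℕ) (M U : ObjectProperty A) : Prop where
  le : U ≤ M
  /-- subcategories are additive: closed under finite direct sums, in particular `0 ∈ U` -/
  finiteSums : U.IsClosedUnderFiniteProducts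
  summands : U.IsStableUnderRetracts
  dExtensions : IsClosedUnderDExtensions d ⊤ U
  dQuotients : IsClosedUnderDQuotients d M U

/-- The subcategory `U_d(E)` of all `X ∈ E` for which there is an exact sequence
`0 ⟶ U_d ⟶ ⋯ ⟶ U₁ ⟶ X ⟶ 0` in `E` with all `Uᵢ ∈ U`. -/
def resolved (d : ℕ) (E U : ObjectProperty A) : ObjectProperty A := fun X =>
  ∃ K : ChainComplex A ℕ, IsAcyclic E K ∧ Nonempty (K.X 0 ≅ X) ∧
    (∀ i, 1 ≤ i → i ≤ d → U (K.X i)) ∧ ∀ i, d < i → IsZero (K.X i)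

end HigherTorsion

-- Three conditions turn out to describe U_d(A): a U-resolution of length d (`Res`), a d-term
-- U-presentation that stays exact under Hom(N, -) for N in M (`ApproxPres`), and a bare d-term
-- U-presentation (`Pres`). The first two agree by dimension shifting: rigidity of M makes every
-- resolution approximating, and conversely the (d-1)st syzygy of an approximating presentation has
-- no Extⁱ from M for 0 < i < d, so it lies in M and, being a quotient of an object of U, in U. The
-- approximating form is the one suited to the horseshoe lemma and to direct summands.
--
-- Closure under extensions. Let 0 → Y → L → K → 0 have K in U and Y in U_d(A). The class of a
-- resolution of Y lies in Ext^{d-1}(Y, V₀) with V₀ in U, and multiplication by it is injective on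
-- Ext¹(N, Y) for N in M. It turns the extension into γ in Ext^d(K, V₀). Closure under d-extensions
-- represents γ by a sequence through U; its map W → K lifts exactly those maps from M that γ kills,
-- which are those that lift to L. Hence W → K lifts to L and, together with a cover of Y,
-- approximates L (`res_of_ses_of_mem`). Induction on the length of a resolution treats arbitrary K.
--
-- Cogeneration. Closure under d-quotients coresolves every quotient of an object of U by U. The
-- same detection argument shows that an object with a d-term presentation and first cosyzygy in
-- U_d(A) is a summand of an object of U_d(A) (`res_of_cosyzygy`). Descent along the coresolution
-- removes the condition on the cosyzygy, so objects of U_d(A) embed into U with cokernel in U_d(A).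
--
-- These embeddings allow a class in Extⁱ(W, Y), 0 < i < d, to be killed by a deflation inside
-- U_d(A). By the general comparison `extVanishes_iff`, Yoneda Ext of U_d(A) then vanishes in these
-- degrees exactly when Ext of A does. Rigidity is inherited from M, and an object with the required
-- vanishing splits off its cover or its hull.

universe w v₁ u₁

/-! ### Effaceability of Ext in an abelian category -/

namespace CategoryTheory.Abelian.Ext

open _root_.DerivedCategory

variable {A : Type u₁} [Category.{v₁} A] [Abelian A]

/-- Write φ as a roof X ← K → L with K in degrees ≤ 0. Every element of K⁰ is then a cycle, so K⁰ →
H⁰(K) = X is epi and K⁰, placed in degree 0, maps to K. Its composite to L vanishes because L⁰ = 0.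
-/
lemma exists_epi_comp_eq_zero_of_derivedCategory [HasDerivedCategory.{w} A] {X : A}
    {L : CochainComplex A ℤ} (φ : Q.obj ((CochainComplex.singleFunctor A 0).obj X) ⟶ Q.obj L)
    (n : ℤ) (hn : n < 0) [L.IsStrictlyLE n] :
    ∃ (V : A) (p : V ⟶ X), Epi p ∧ Q.map ((CochainComplex.singleFunctor A 0).map p) ≫ φ = 0 := by
  obtain ⟨K, _, s, hs, g, rfl⟩ := right_fac_of_isStrictlyLE φ 0
  have hs' : QuasiIso s := by rwa [isIso_Q_map_iff_quasiIso] at hs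
  let S := (CochainComplex.singleFunctor A 0).obj X
  let α : K.X 0 ⟶ X := s.f 0 ≫ (HomologicalComplex.singleObjXSelf (ComplexShape.up ℤ) 0 X).hom
  have hα : Epi (s.f 0) := by
    have h₁ : IsIso (S.homologyπ 0) :=
      S.isIso_homologyπ (-1) 0 (by simp) ((S.isZero_of_isStrictlyGE 0 (-1) (by simp)).eq_of_src _ _)
    have h₂ : IsIso (S.iCycles 0) :=
      S.isIso_iCycles 0 1 (by simp) ((S.isZero_of_isStrictlyLE 0 1 (by simp)).eq_of_tgt _ _)
    have h₃ : Epi (HomologicalComplex.cyclesMap s 0) := by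
      have : Epi (HomologicalComplex.cyclesMap s 0 ≫ S.homologyπ 0) := by
        rw [← HomologicalComplex.homologyπ_naturality]
        infer_instance
      rw [← Category.comp_id (HomologicalComplex.cyclesMap s 0), ← IsIso.hom_inv_id (S.homologyπ 0),
        ← Category.assoc]
      infer_instance
    have : Epi (K.iCycles 0 ≫ s.f 0) := by
      rw [← HomologicalComplex.cyclesMap_i]
      exact epi_comp _ _
    exact epi_of_epi (K.iCycles 0) (s.f 0)
  let ι : (CochainComplex.singleFunctor A 0).obj (K.X 0) ⟶ K :=
    HomologicalComplex.mkHomFromSingle (𝟙 _) (by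
      rintro _ rfl
      apply (K.isZero_of_isStrictlyLE 0 (0 + 1) (by simp)).eq_of_tgt)
  have h0 : (CochainComplex.singleFunctor A 0).map α = ι ≫ s := by
    apply HomologicalComplex.from_single_hom_ext
    refine (HomologicalComplex.single_map_f_self (ComplexShape.up ℤ) 0 α).trans ?_
    refine Eq.trans ?_ (congrArg (· ≫ s.f 0) (HomologicalComplex.mkHomFromSingle_f _ _)).symm
    change _ = ((HomologicalComplex.singleObjXSelf (ComplexShape.up ℤ) 0 (K.X 0)).hom ≫ 𝟙 _) ≫ s.f 0
    rw [Category.comp_id]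
    congr 1
    refine (Category.assoc _ _ _).trans ?_
    refine (congrArg (s.f 0 ≫ ·) (Iso.hom_inv_id _)).trans (Category.comp_id _)
  have h1 : ι ≫ g = 0 := by
    apply HomologicalComplex.from_single_hom_ext
    apply (L.isZero_of_isStrictlyLE n 0 hn).eq_of_tgt
  refine ⟨K.X 0, α, ?_, ?_⟩
  · exact epi_comp' hα (IsIso.epi_of_iso (HomologicalComplex.singleObjXSelf (ComplexShape.up ℤ) 0 X).hom)
  · rw [h0, Q.map_comp, Category.assoc, IsIso.hom_inv_id_assoc, ← Q.map_comp, h1, Q.map_zero]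

/-- Higher extension classes are effaceable. -/
lemma exists_epi_comp_eq_zero [HasExt.{w} A] {X Y : A} {n : ℕ} (x : Ext.{w} X Y (n + 1)) :
    ∃ (V : A) (p : V ⟶ X), Epi p ∧ (mk₀ p).comp x (zero_add _) = 0 := by
  let := HasDerivedCategory.standard A
  let e := ((singleFunctors A).shiftIso ((n : ℤ) + 1) (-((n : ℤ) + 1)) 0 (by lia)).hom.app Y
  obtain ⟨V, p, hp, h⟩ := exists_epi_comp_eq_zero_of_derivedCategory
    (L := (CochainComplex.singleFunctor A (-((n : ℤ) + 1))).obj Y)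
    (x.hom ≫ e) (-((n : ℤ) + 1)) (by lia)
  refine ⟨V, p, hp, ?_⟩
  apply homEquiv.injective
  change ((mk₀ p).comp x (zero_add _)).hom = (0 : Ext V Y (n + 1)).hom
  rw [zero_hom, ← singleFunctor_map_comp_hom]
  apply (cancel_mono e).1
  rw [Category.assoc, Limits.zero_comp]
  exact h

end CategoryTheory.Abelian.Ext

/-! ### Short exact sequences and their classes -/

namespace HigherTorsion

open Abelian

variable {A : Type u₁} [Category.{v₁} A] [Abelian A]

/-- The morphisms `i` and `p` form a short exact sequence. -/
def SES {K X Y : A} (i : K ⟶ X) (p : X ⟶ Y) : Prop :=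
  ∃ w : i ≫ p = 0, (ShortComplex.mk i p w).ShortExact

namespace SES

section

variable {K X Y : A} {i : K ⟶ X} {p : X ⟶ Y}

lemma mk' (w : i ≫ p = 0) (hi : Mono i) (hp : Epi p)
    (h : ∀ {N : A} (g : N ⟶ X), g ≫ p = 0 → ∃ k, k ≫ i = g) : SES i p := by
  refine ⟨w, { exact := ?_, mono_f := hi, epi_g := hp }⟩
  apply ShortComplex.exact_of_f_is_kernel
  exact KernelFork.IsLimit.ofι' _ _ fun g hg => ⟨(h g hg).choose, (h g hg).choose_spec⟩

lemma of_shortExact {S : ShortComplex A} (hS : S.ShortExact) : SES S.f S.g := ⟨S.zero, hS⟩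

lemma zero (h : SES i p) : i ≫ p = 0 := h.1
lemma mono (h : SES i p) : Mono i := h.2.mono_f
lemma epi (h : SES i p) : Epi p := h.2.epi_g

lemma exists_lift (h : SES i p) {N : A} (g : N ⟶ X) (hg : g ≫ p = 0) : ∃ k, k ≫ i = g := by
  have := h.mono
  exact ⟨h.2.exact.lift g hg, h.2.exact.lift_f g hg⟩

lemma exists_desc (h : SES i p) {N : A} (g : X ⟶ N) (hg : i ≫ g = 0) : ∃ k, p ≫ k = g := by
  have := h.epi
  exact ⟨h.2.exact.desc g hg, h.2.exact.g_desc g hg⟩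

lemma of_epi {X Y : A} (p : X ⟶ Y) [Epi p] : SES (kernel.ι p) p :=
  mk' (kernel.condition p) inferInstance inferInstance
    fun g hg => ⟨kernel.lift p g hg, kernel.lift_ι p g hg⟩

lemma of_mono {K X : A} (i : K ⟶ X) [Mono i] : SES i (cokernel.π i) :=
  ⟨cokernel.condition i, { exact := ShortComplex.exact_cokernel i }⟩

lemma of_iso {K' X' Y' : A} {i' : K' ⟶ X'} {p' : X' ⟶ Y'} (h : SES i p)
    (a : K ≅ K') (b : X ≅ X') (c : Y ≅ Y') (h₁ : i ≫ b.hom = a.hom ≫ i')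
    (h₂ : p ≫ c.hom = b.hom ≫ p') : SES i' p' := by
  have hi' : i' = a.inv ≫ i ≫ b.hom := by rw [h₁]; simp
  have hp' : p' = b.inv ≫ p ≫ c.hom := by rw [h₂]; simp
  have w : i' ≫ p' = 0 := by rw [hi', hp']; simp [reassoc_of% h.zero]
  exact ⟨w, ShortComplex.shortExact_of_iso (S₁ := ShortComplex.mk i p h.zero)
    (ShortComplex.isoMk a b c h₁.symm h₂.symm) h.2⟩

lemma isIso_of_isZero_left (h : SES i p) (hK : IsZero K) : IsIso p := by
  have := h.epi
  have : Mono p := h.2.exact.mono_g (hK.eq_of_src _ _)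
  exact isIso_of_mono_of_epi p

lemma of_isIso (hp : IsIso p) (hK : IsZero K) : SES i p :=
  mk' (hK.eq_of_src _ _) ⟨fun _ _ _ => hK.eq_of_tgt _ _⟩ inferInstance
    fun g hg => ⟨0, by rw [← cancel_mono p, hg]; simp⟩

/-- The pullback of a short exact sequence. -/
lemma exists_pullback (h : SES i p) {W : A} (f : W ⟶ Y) :
    ∃ (F : A) (j : K ⟶ F) (q : F ⟶ W) (g : F ⟶ X), SES j q ∧ j ≫ g = i ∧ g ≫ p = q ≫ f ∧
      ∀ {N : A} (a : N ⟶ X) (b : N ⟶ W), a ≫ p = b ≫ f → ∃ c, c ≫ g = a ∧ c ≫ q = b := by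
  have := h.mono
  have := h.epi
  let j : K ⟶ pullback p f := pullback.lift i 0 (by simp [h.zero])
  have hj : j ≫ pullback.fst p f = i := pullback.lift_fst _ _ _
  have hj' : j ≫ pullback.snd p f = 0 := pullback.lift_snd _ _ _
  refine ⟨pullback p f, j, pullback.snd p f, pullback.fst p f,
    mk' hj' ⟨fun a b hab => ?_⟩ inferInstance fun g hg => ?_, hj,
    pullback.condition, fun a b hab => ⟨pullback.lift a b hab, pullback.lift_fst _ _ _,
      pullback.lift_snd _ _ _⟩⟩
  · have := congrArg (· ≫ pullback.fst p f) hab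
    simpa [hj, cancel_mono] using this
  · obtain ⟨k, hk⟩ := h.exists_lift (g ≫ pullback.fst p f)
      (by rw [Category.assoc, pullback.condition, reassoc_of% hg, zero_comp])
    exact ⟨k, pullback.hom_ext (by simp [hj, hk]) (by simp [hg, hj'])⟩

/-- The pullback of two short exact sequences with the same right end. -/
lemma exists_pullback₂ (h : SES i p) {K' X' : A} {i' : K' ⟶ X'} {p' : X' ⟶ Y} (h' : SES i' p') :
    ∃ (F : A) (j : K ⟶ F) (q : F ⟶ X') (j' : K' ⟶ F) (g : F ⟶ X), SES j q ∧ SES j' g ∧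
      g ≫ p = q ≫ p' ∧
      ∀ {N : A} (a : N ⟶ X) (b : N ⟶ X'), a ≫ p = b ≫ p' → ∃ c, c ≫ g = a ∧ c ≫ q = b := by
  have := h.mono
  have := h'.mono
  obtain ⟨F, j, q, g, hF, hjg, hgq, hl⟩ := h.exists_pullback p'
  obtain ⟨F', j', q', g', hF', -, hgq', -⟩ := h'.exists_pullback p
  have := hF'.epi
  obtain ⟨k, hk, hk'⟩ := hl 0 i' (by rw [h'.zero, zero_comp])
  obtain ⟨c, hc, -⟩ := hl q' g' hgq'.symm
  refine ⟨F, j, q, k, g, hF, SES.mk' hk ?_ ?_ fun {N} x hx => ?_, hgq, hl⟩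
  · have : Mono (k ≫ q) := by rw [hk']; infer_instance
    exact mono_of_mono k q
  · have : Epi (c ≫ g) := by rw [hc]; infer_instance
    exact epi_of_epi c g
  · obtain ⟨y, hy⟩ := h'.exists_lift (x ≫ q) (by
      rw [Category.assoc, ← hgq, reassoc_of% hx, zero_comp])
    obtain ⟨z, hz⟩ := hF.exists_lift (x - y ≫ k) (by simp [hk', hy])
    have : z = 0 := by
      rw [← cancel_mono i, ← hjg, reassoc_of% hz]
      simp [hx, hk]
    rw [this, zero_comp] at hz
    exact ⟨y, (sub_eq_zero.1 hz.symm).symm⟩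

/-- The pushout of a short exact sequence. -/
lemma exists_pushout (h : SES i p) {K' : A} (c : K ⟶ K') :
    ∃ (F : A) (j : K' ⟶ F) (q : F ⟶ Y) (g : X ⟶ F), SES j q ∧ i ≫ g = c ≫ j ∧ g ≫ q = p := by
  have := h.mono
  have := h.epi
  let q : pushout i c ⟶ Y := pushout.desc p 0 (by simp [h.zero])
  have hq : pushout.inl i c ≫ q = p := pushout.inl_desc _ _ _
  have hq' : pushout.inr i c ≫ q = 0 := pushout.inr_desc _ _ _
  have : Epi q := by
    have : Epi (pushout.inl i c ≫ q) := by rw [hq]; infer_instance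
    exact epi_of_epi (pushout.inl i c) q
  refine ⟨pushout i c, pushout.inr i c, q, pushout.inl i c,
    ⟨hq', { exact := ?_, mono_f := inferInstanceAs (Mono (pushout.inr i c)), epi_g := this }⟩,
    pushout.condition, hq⟩
  apply ShortComplex.exact_of_g_is_cokernel
  refine CokernelCofork.IsColimit.ofπ' _ _ fun {N} g hg => ?_
  replace hg : pushout.inr i c ≫ g = 0 := hg
  have h₀ : i ≫ pushout.inl i c ≫ g = 0 := by
    rw [reassoc_of% (pushout.condition (f := i) (g := c)), hg, comp_zero]
  refine ⟨(h.exists_desc (pushout.inl i c ≫ g) h₀).choose, ?_⟩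
  have hk := (h.exists_desc (pushout.inl i c ≫ g) h₀).choose_spec
  apply pushout.hom_ext
  · rw [reassoc_of% hq, hk]
  · change pushout.inr i c ≫ q ≫ _ = pushout.inr i c ≫ g
    rw [reassoc_of% hq', zero_comp]
    exact hg.symm

/-- The kernel of a composition of epimorphisms. -/
lemma exists_comp (h : SES i p) {L Z : A} {l : L ⟶ Z} {q : Z ⟶ X} (h' : SES l q) :
    ∃ (T : A) (t : T ⟶ Z) (a : L ⟶ T) (b : T ⟶ K), SES t (q ≫ p) ∧ SES a b ∧
      a ≫ t = l ∧ b ≫ i = t ≫ q := by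
  have := h.mono
  have := h.epi
  have := h'.epi
  obtain ⟨T, a, b, t, hab, hat, htq, hlift⟩ := h'.exists_pullback i
  refine ⟨T, t, a, b, mk' ?_ ⟨fun {N} x y hxy => ?_⟩ inferInstance fun g hg => ?_, hab, hat, htq.symm⟩
  · rw [reassoc_of% htq, h.zero, comp_zero]
  · have h1 : (x - y) ≫ t = 0 := by simp [hxy]
    have h2 : (x - y) ≫ b = 0 := by
      rw [← cancel_mono i, Category.assoc, ← htq, reassoc_of% h1]; simp
    obtain ⟨k, hk⟩ := hab.exists_lift _ h2
    have : k = 0 := by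
      have := h'.mono
      rw [← cancel_mono l, ← hat, reassoc_of% hk, h1, zero_comp]
    rw [this, zero_comp] at hk
    exact sub_eq_zero.1 hk.symm
  · obtain ⟨k, hk⟩ := h.exists_lift (g ≫ q) (by simpa using hg)
    obtain ⟨c, hc, -⟩ := hlift g k hk.symm
    exact ⟨c, hc⟩

end

section Ext

variable [HasExt.{w} A] {K X Y : A} {i : K ⟶ X} {p : X ⟶ Y}

/-- The class of a short exact sequence. -/
noncomputable def cls (h : SES i p) : Ext.{w} Y K 1 := h.2.extClass

lemma comp_cls (h : SES i p) : (Ext.mk₀ p).comp (h.cls : Ext.{w} Y K 1) (zero_add 1) = 0 :=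
  h.2.comp_extClass

lemma cls_naturality (h : SES i p) {K' X' Y' : A} {i' : K' ⟶ X'} {p' : X' ⟶ Y'}
    (h' : SES i' p') {a : K ⟶ K'} {b : X ⟶ X'} {c : Y ⟶ Y'} (h₁ : i ≫ b = a ≫ i')
    (h₂ : b ≫ p' = p ≫ c) :
    (h.cls : Ext.{w} Y K 1).comp (Ext.mk₀ a) (add_zero 1) =
      (Ext.mk₀ c).comp h'.cls (zero_add 1) :=
  ShortComplex.ShortExact.extClass_naturality h.2 h'.2
    { τ₁ := a, τ₂ := b, τ₃ := c, comm₁₂ := h₁.symm, comm₂₃ := h₂ }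

lemma cov₁ (h : SES i p) {N : A} {n m : ℕ} (x : Ext.{w} N K m)
    (hx : x.comp (Ext.mk₀ i) (add_zero m) = 0) (hn : n + 1 = m) :
    ∃ y : Ext.{w} N Y n, y.comp h.cls hn = x :=
  Ext.covariant_sequence_exact₁ N h.2 x hx hn

lemma cov₃ (h : SES i p) {N : A} {n m : ℕ} (x : Ext.{w} N Y n) (hn : n + 1 = m)
    (hx : x.comp h.cls hn = 0) :
    ∃ y : Ext.{w} N X n, y.comp (Ext.mk₀ p) (add_zero n) = x :=
  Ext.covariant_sequence_exact₃ N h.2 x hn hx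

lemma contra₁ (h : SES i p) {N : A} {n m : ℕ} (x : Ext.{w} K N n) (hn : 1 + n = m)
    (hx : h.cls.comp x hn = 0) :
    ∃ y : Ext.{w} X N n, (Ext.mk₀ i).comp y (zero_add n) = x :=
  Ext.contravariant_sequence_exact₁ h.2 N x hn hx

lemma contra₃ (h : SES i p) {N : A} {n m : ℕ} (x : Ext.{w} Y N m)
    (hx : (Ext.mk₀ p).comp x (zero_add m) = 0) (hn : 1 + n = m) :
    ∃ y : Ext.{w} K N n, h.cls.comp y hn = x :=
  Ext.contravariant_sequence_exact₃ h.2 N x hx hn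

lemma exists_lift_iff (h : SES i p) {N : A} (g : N ⟶ Y) :
    (∃ l, l ≫ p = g) ↔ (Ext.mk₀ g).comp (h.cls : Ext.{w} Y K 1) (zero_add 1) = 0 := by
  constructor
  · rintro ⟨l, rfl⟩
    rw [← Ext.mk₀_comp_mk₀, Ext.comp_assoc_of_second_deg_zero, h.comp_cls, Ext.comp_zero]
  · intro hg
    obtain ⟨y, hy⟩ := h.cov₃ _ _ hg
    obtain ⟨l, rfl⟩ := (Ext.mk₀_bijective N X).2 y
    refine ⟨l, (Ext.mk₀_bijective N Y).1 ?_⟩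
    rw [← hy, Ext.mk₀_comp_mk₀]

/-- A commutation of extension classes is realized by a morphism of short exact sequences. -/
lemma exists_hom_of_cls_eq (h : SES i p) {K' X' Y' : A} {i' : K' ⟶ X'} {p' : X' ⟶ Y'}
    (h' : SES i' p') (a : K ⟶ K') (c : Y ⟶ Y')
    (H : (h.cls : Ext.{w} Y K 1).comp (Ext.mk₀ a) (add_zero 1) =
      (Ext.mk₀ c).comp h'.cls (zero_add 1)) :
    ∃ b : X ⟶ X', i ≫ b = a ≫ i' ∧ b ≫ p' = p ≫ c := by
  obtain ⟨b, hb⟩ := (h'.exists_lift_iff (p ≫ c)).2 (by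
    rw [← Ext.mk₀_comp_mk₀, Ext.comp_assoc_of_second_deg_zero, ← H,
      ← Ext.comp_assoc_of_third_deg_zero, h.comp_cls, Ext.zero_comp])
  obtain ⟨a', ha'⟩ := h'.exists_lift (i ≫ b) (by rw [Category.assoc, hb, reassoc_of% h.zero, zero_comp])
  have H' := h.cls_naturality (a := a') h' ha'.symm hb
  -- The lift `b` may induce some `a'` other than `a` on the kernels. The class of the first
  -- sequence kills `a' - a`, which therefore extends along `i` and can be subtracted from `b`.
  obtain ⟨y, hy⟩ := h.contra₁ (Ext.mk₀ (a' - a)) (add_zero 1) (by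
    rw [sub_eq_add_neg, Ext.mk₀_add, Ext.mk₀_neg, Ext.comp_add, Ext.comp_neg, H', H, add_neg_cancel])
  obtain ⟨s, rfl⟩ := (Ext.mk₀_bijective _ _).2 y
  rw [Ext.mk₀_comp_mk₀] at hy
  have hs := (Ext.mk₀_bijective _ _).1 hy
  refine ⟨b - s ≫ i', ?_, ?_⟩
  · rw [Preadditive.comp_sub, reassoc_of% hs, ← ha']; simp
  · rw [Preadditive.sub_comp, Category.assoc, h'.zero, comp_zero, sub_zero, hb]

end Ext

end SES

end HigherTorsion

/-! ### Exact sequences of arbitrary length and their classes in Ext -/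

namespace HigherTorsion

open Abelian

variable {A : Type u₁} [Category.{v₁} A] [Abelian A]

lemma conflation_mk_iff {E : ObjectProperty A} {K X Y : A} {i : K ⟶ X} {p : X ⟶ Y} (w : i ≫ p = 0) :
    Conflation E (ShortComplex.mk i p w) ↔ SES i p ∧ E K ∧ E X ∧ E Y :=
  ⟨fun h => ⟨⟨w, h.1⟩, h.2⟩, fun h => ⟨h.1.2, h.2⟩⟩

/-- The conflations witnessing that a chain complex is acyclic in `E`. -/
structure AcyclicData (E : ObjectProperty A) (K : ChainComplex A ℕ) where
  /-- the cycles -/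
  Z : ℕ → A
  /-- the inclusion of the cycles -/
  j : ∀ i, Z i ⟶ K.X i
  /-- the projection onto the cycles -/
  p : ∀ i, K.X (i + 1) ⟶ Z i
  isIso : IsIso (j 0)
  fac : ∀ i, K.d (i + 1) i = p i ≫ j i
  ses : ∀ i, SES (j (i + 1)) (p i)
  mem : ∀ i, E (Z i)
  mem_X : ∀ i, E (K.X (i + 1))

section

variable [HasExt.{w} A]

/-- The composition of the first `k` classes of a sequence of extension classes. -/
noncomputable def iterClass (Z : ℕ → A) (e : ∀ k, Ext.{w} (Z k) (Z (k + 1)) 1) :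
    ∀ k, Ext.{w} (Z 0) (Z k) k
  | 0 => Ext.mk₀ (𝟙 _)
  | k + 1 => (iterClass Z e k).comp (e k) rfl

/-- The recursive definition splits off the last factor. Splicing a conflation at the right end
requires splitting off the first one. -/
lemma iterClass_succ (Z : ℕ → A) (e : ∀ k, Ext.{w} (Z k) (Z (k + 1)) 1) (k : ℕ) :
    iterClass Z e (k + 1) =
      (e 0).comp (iterClass (fun k => Z (k + 1)) (fun k => e (k + 1)) k) (add_comm 1 k) := by
  induction k with
  | zero => rw [iterClass, iterClass, iterClass, Ext.mk₀_id_comp, Ext.comp_mk₀_id]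
  | succ k ih => rw [iterClass, ih, iterClass, Ext.comp_assoc _ _ _ _ rfl (by omega)]

end

namespace AcyclicData

variable {E : ObjectProperty A} {K : ChainComplex A ℕ}

lemma nonempty_iff : IsAcyclic E K ↔ Nonempty (AcyclicData E K) := by
  constructor
  · rintro ⟨Z, j, p, w, h₁, h₂, h₃⟩
    refine ⟨⟨Z, j, p, h₁, h₂, fun i => ⟨w i, (h₃ i).1⟩, fun i => (h₃ i).2.2.2, fun i => (h₃ i).2.2.1⟩⟩
  · rintro ⟨D⟩
    exact ⟨D.Z, D.j, D.p, fun i => (D.ses i).zero, D.isIso, D.fac,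
      fun i => (conflation_mk_iff _).2 ⟨D.ses i, D.mem _, D.mem_X _, D.mem _⟩⟩

lemma mono_j (D : AcyclicData E K) : ∀ i, Mono (D.j i)
  | 0 => have := D.isIso; inferInstance
  | i + 1 => (D.ses i).mono

lemma isZero_Z (D : AcyclicData E K) {n : ℕ} (h : IsZero (K.X (n + 1))) : IsZero (D.Z n) :=
  have := (D.ses n).epi
  IsZero.of_epi (D.p n) h

lemma exists_map (D : AcyclicData E K) {E' : ObjectProperty A} {K' : ChainComplex A ℕ}
    (D' : AcyclicData E' K') (φ : K ⟶ K') :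
    ∃ z : ∀ k, D.Z k ⟶ D'.Z k, (∀ k, z k ≫ D'.j k = D.j k ≫ φ.f k) ∧
      ∀ k, D.p k ≫ z k = φ.f (k + 1) ≫ D'.p k := by
  have key : ∀ k (z : D.Z k ⟶ D'.Z k), z ≫ D'.j k = D.j k ≫ φ.f k →
      D.p k ≫ z = φ.f (k + 1) ≫ D'.p k := fun k z hz => by
    have := D'.mono_j k
    rw [← cancel_mono (D'.j k), Category.assoc, hz, Category.assoc, ← D'.fac, φ.comm, D.fac,
      Category.assoc]
  have : ∀ k, ∃ z : D.Z k ⟶ D'.Z k, z ≫ D'.j k = D.j k ≫ φ.f k := by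
    intro k
    induction k with
    | zero =>
      have := D'.isIso
      exact ⟨D.j 0 ≫ φ.f 0 ≫ inv (D'.j 0), by simp⟩
    | succ k ih =>
      obtain ⟨z, hz⟩ := ih
      exact (D'.ses k).exists_lift _ (by
        rw [Category.assoc, ← key k z hz, reassoc_of% (D.ses k).zero, zero_comp])
  choose z hz using this
  exact ⟨z, hz, fun k => key k _ (hz k)⟩

variable [HasExt.{w} A]

/-- The composition of the classes of the first `k` conflations. -/
noncomputable def cls (D : AcyclicData E K) (k : ℕ) : Ext.{w} (D.Z 0) (D.Z k) k :=
  iterClass D.Z (fun k => (D.ses k).cls) k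

lemma cls_zero (D : AcyclicData E K) : (D.cls 0 : Ext.{w} _ _ _) = Ext.mk₀ (𝟙 _) := rfl

lemma cls_succ (D : AcyclicData E K) (k : ℕ) :
    (D.cls (k + 1) : Ext.{w} _ _ _) = (D.cls k).comp (D.ses k).cls rfl := rfl

lemma cls_naturality (D : AcyclicData E K) {E' : ObjectProperty A} {K' : ChainComplex A ℕ}
    (D' : AcyclicData E' K') (φ : K ⟶ K') (z : ∀ k, D.Z k ⟶ D'.Z k)
    (h₁ : ∀ k, z k ≫ D'.j k = D.j k ≫ φ.f k) (h₂ : ∀ k, D.p k ≫ z k = φ.f (k + 1) ≫ D'.p k)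
    (k : ℕ) :
    (D.cls k : Ext.{w} _ _ _).comp (Ext.mk₀ (z k)) (add_zero k) =
      (Ext.mk₀ (z 0)).comp (D'.cls k) (zero_add k) := by
  induction k with
  | zero => simp [cls_zero]
  | succ k ih =>
    rw [cls_succ, cls_succ, Ext.comp_assoc_of_third_deg_zero,
      (D.ses k).cls_naturality (D'.ses k) (h₁ (k + 1)).symm (h₂ k).symm,
      ← Ext.comp_assoc_of_second_deg_zero, ih, Ext.comp_assoc _ _ _ _ _ (by omega)]

lemma comp_cls_eq_zero (D : AcyclicData E K) (k : ℕ) :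
    (Ext.mk₀ (D.p 0)).comp (D.cls (k + 1) : Ext.{w} _ _ _) (zero_add _) = 0 := by
  induction k with
  | zero => rw [cls_succ, cls_zero, Ext.mk₀_id_comp, (D.ses 0).comp_cls]
  | succ k ih =>
    rw [cls_succ, ← Ext.comp_assoc (a₁₂ := k + 1) _ _ _ (by omega) (by omega) (by omega), ih, Ext.zero_comp]

end AcyclicData

namespace NExtension

variable {E : ObjectProperty A} {n : ℕ} {X Y : A}

lemma isIso_p (ξ : NExtension E n X Y) (D : AcyclicData E ξ.K) : IsIso (D.p n) :=
  (D.ses n).isIso_of_isZero_left (D.isZero_Z (ξ.isZero _ (by omega)))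

/-- There is a morphism of exact sequences over `f` on the right, identical on the left. -/
def MapsOver {X' : A} (f : X ⟶ X') (ξ : NExtension E n X Y) (ζ : NExtension E n X' Y) : Prop :=
  ∃ φ : ξ.K ⟶ ζ.K, φ.f 0 ≫ ζ.right.hom = ξ.right.hom ≫ f ∧
    φ.f (n + 1) ≫ ζ.left.hom = ξ.left.hom

lemma MapsTo.mapsOver {ξ ζ : NExtension E n X Y} (h : ξ.MapsTo ζ) : MapsOver (𝟙 X) ξ ζ := by
  obtain ⟨φ, h₁, h₂⟩ := h
  exact ⟨φ, by simpa using h₁, h₂⟩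

lemma MapsOver.mapsTo {ξ ζ : NExtension E n X Y} (h : MapsOver (𝟙 X) ξ ζ) : ξ.MapsTo ζ := by
  obtain ⟨φ, h₁, h₂⟩ := h
  exact ⟨φ, by simpa using h₁, h₂⟩

lemma MapsTo.refl (ξ : NExtension E n X Y) : ξ.MapsTo ξ := ⟨𝟙 _, by simp, by simp⟩

variable [HasExt.{w} A]

/-- `x` is the class of the exact sequence `ξ` in the derived category. -/
def HasClass (ξ : NExtension E n X Y) (x : Ext.{w} X Y n) : Prop :=
  ∃ (D : AcyclicData E ξ.K) (b : D.Z n ⟶ Y), D.p n ≫ b = ξ.left.hom ∧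
    (Ext.mk₀ (D.j 0 ≫ ξ.right.hom)).comp x (zero_add n) = (D.cls n).comp (Ext.mk₀ b) (add_zero n)

lemma eq_of_mk₀_comp_eq {X X' Y : A} (f : X ⟶ X') [IsIso f] {n : ℕ} {x y : Ext.{w} X' Y n}
    (h : (Ext.mk₀ f).comp x (zero_add n) = (Ext.mk₀ f).comp y (zero_add n)) : x = y := by
  have := congrArg (fun z => (Ext.mk₀ (inv f)).comp z (zero_add n)) h
  simpa using this

lemma exists_hasClass (ξ : NExtension E n X Y) : ∃ x : Ext.{w} X Y n, ξ.HasClass x := by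
  obtain ⟨D⟩ := AcyclicData.nonempty_iff.1 ξ.acyclic
  have := ξ.isIso_p D
  have := D.isIso
  refine ⟨(Ext.mk₀ (inv (D.j 0 ≫ ξ.right.hom))).comp
    ((D.cls n).comp (Ext.mk₀ (inv (D.p n) ≫ ξ.left.hom)) (add_zero n)) (zero_add n), D,
    inv (D.p n) ≫ ξ.left.hom, by simp, ?_⟩
  rw [Ext.mk₀_comp_mk₀_assoc, IsIso.hom_inv_id, Ext.mk₀_id_comp]

/-- Naturality of the connecting classes, one conflation at a time. For `f` the identity it makes
the class an invariant of Yoneda equivalence. -/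
lemma HasClass.eq_of_mapsOver {X' : A} {f : X ⟶ X'} {ξ : NExtension E n X Y}
    {ζ : NExtension E n X' Y} {x : Ext.{w} X Y n} {y : Ext.{w} X' Y n} (hx : ξ.HasClass x)
    (hy : ζ.HasClass y) (h : MapsOver f ξ ζ) : x = (Ext.mk₀ f).comp y (zero_add n) := by
  obtain ⟨D, b, hb, hx⟩ := hx
  obtain ⟨D', b', hb', hy⟩ := hy
  obtain ⟨φ, h₁, h₂⟩ := h
  obtain ⟨z, hz, hz'⟩ := D.exists_map D' φ
  have := D.isIso
  have := (D.ses n).epi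
  have hbb : b = z n ≫ b' := by
    rw [← cancel_epi (D.p n), hb, reassoc_of% hz', hb', h₂]
  apply eq_of_mk₀_comp_eq (D.j 0 ≫ ξ.right.hom)
  rw [hx, hbb, ← Ext.mk₀_comp_mk₀, ← Ext.comp_assoc_of_third_deg_zero,
    D.cls_naturality D' φ z hz hz', Ext.comp_assoc_of_third_deg_zero, ← hy,
    Ext.mk₀_comp_mk₀_assoc, Ext.mk₀_comp_mk₀_assoc, reassoc_of% hz, h₁, Category.assoc]

lemma HasClass.eq_of_mapsTo {ξ ζ : NExtension E n X Y} {x y : Ext.{w} X Y n} (hx : ξ.HasClass x)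
    (hy : ζ.HasClass y) (h : ξ.MapsTo ζ) : x = y := by
  simpa using hx.eq_of_mapsOver hy h.mapsOver

lemma HasClass.unique {ξ : NExtension E n X Y} {x y : Ext.{w} X Y n} (hx : ξ.HasClass x)
    (hy : ξ.HasClass y) : x = y := hx.eq_of_mapsTo hy (.refl _)

lemma HasClass.eq_of_yonedaEquiv {ξ ζ : NExtension E n X Y} {x y : Ext.{w} X Y n}
    (hx : ξ.HasClass x) (hy : ζ.HasClass y) (h : ξ.YonedaEquiv ζ) : x = y := by
  obtain ⟨η, h₁, h₂⟩ := h
  obtain ⟨z, hz⟩ := η.exists_hasClass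
  rw [← hz.eq_of_mapsTo hx h₁, hz.eq_of_mapsTo hy h₂]

/-! ### Splicing -/

section Cons

variable {Z F : A}

/-- The complex `⋯ ⟶ K₂ ⟶ K₁ ⟶ F ⟶ X` obtained from a complex `⋯ ⟶ K₂ ⟶ K₁ ⟶ K₀` and
`K₀ ⟶ F ⟶ X`. -/
noncomputable def spliceComplex (K : ChainComplex A ℕ) (f : K.X 0 ⟶ F) (g : F ⟶ X) (h : f ≫ g = 0) :
    ChainComplex A ℕ :=
  ((ChainComplex.truncate.obj K).augment (K.d 1 0 ≫ f)
    ((K.d_comp_d_assoc 2 1 0 f).trans zero_comp)).augment g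
    ((Category.assoc (K.d 1 0) f g).trans ((congrArg _ h).trans comp_zero))

variable {i : Z ⟶ F} {p : F ⟶ X}

/-- Splicing acyclic complexes. -/
noncomputable def spliceData {K : ChainComplex A ℕ} (D : AcyclicData E K) (e : K.X 0 ≅ Z)
    (hS : SES i p) (hF : E F) (hX : E X) :
    AcyclicData E (spliceComplex K (e.hom ≫ i) p (by rw [Category.assoc, hS.zero, comp_zero])) where
  Z
    | 0 => X
    | k + 1 => D.Z k
  j
    | 0 => 𝟙 X
    | 1 => D.j 0 ≫ e.hom ≫ i
    | k + 2 => D.j (k + 1)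
  p
    | 0 => p
    | k + 1 => D.p k
  isIso := inferInstanceAs (IsIso (𝟙 X))
  fac
    | 0 => (Category.comp_id p).symm
    | 1 => (congrArg (· ≫ e.hom ≫ i) (D.fac 0)).trans (Category.assoc _ _ _)
    | k + 2 => D.fac (k + 1)
  ses
    | 0 => by
      have := D.isIso
      exact hS.of_iso (asIso (D.j 0 ≫ e.hom)).symm (Iso.refl F) (Iso.refl X)
        ((Category.comp_id i).trans (by simp)) ((Category.comp_id p).trans (Category.id_comp p).symm)
    | k + 1 => D.ses k
  mem
    | 0 => hX
    | k + 1 => D.mem k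
  mem_X
    | 0 => hF
    | k + 1 => D.mem_X k

/-- Splicing a conflation and an exact sequence. -/
noncomputable def cons (hS : SES i p) (hF : E F) (hX : E X) (η : NExtension E n Z Y) :
    NExtension E (n + 1) X Y where
  K := spliceComplex η.K (η.right.hom ≫ i) p (by rw [Category.assoc, hS.zero, comp_zero])
  right := Iso.refl X
  left := η.left
  isZero
    | 0, h => by omega
    | 1, h => by omega
    | k + 2, h => η.isZero (k + 1) (by omega)
  acyclic := by
    obtain ⟨D⟩ := AcyclicData.nonempty_iff.1 η.acyclic
    exact AcyclicData.nonempty_iff.2 ⟨spliceData D η.right hS hF hX⟩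

lemma comp_eq_comp_of_comp_mk₀_eq {X Z W T Y : A} {e₀ : Ext.{w} X W 1} {e : Ext.{w} X Z 1} {t : W ⟶ Z}
    (h : e₀.comp (Ext.mk₀ t) (add_zero 1) = e) {c : Ext.{w} W T n} {b : T ⟶ Y} {x : Ext.{w} Z Y n}
    (hx : (Ext.mk₀ t).comp x (zero_add n) = c.comp (Ext.mk₀ b) (add_zero n)) :
    e.comp x (add_comm 1 n) = (e₀.comp c (add_comm 1 n)).comp (Ext.mk₀ b) (add_zero _) := by
  rw [← h, Ext.comp_assoc_of_third_deg_zero, ← hx, Ext.comp_assoc_of_second_deg_zero]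

lemma HasClass.cons (hS : SES i p) (hF : E F) (hX : E X) {η : NExtension E n Z Y}
    {x : Ext.{w} Z Y n} (hx : η.HasClass x) :
    (cons hS hF hX η).HasClass (hS.cls.comp x (add_comm 1 n)) := by
  obtain ⟨D, b, hb, hx⟩ := hx
  let D' := spliceData D η.right hS hF hX
  refine ⟨D', b, hb, ?_⟩
  have h₁ : ((D'.ses 0).cls : Ext.{w} X (D.Z 0) 1).comp (Ext.mk₀ (D.j 0 ≫ η.right.hom)) (add_zero 1) =
      hS.cls := by
    have := (D'.ses 0).cls_naturality.{w} hS (a := D.j 0 ≫ η.right.hom) (b := 𝟙 F) (c := 𝟙 X)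
      ((Category.comp_id _).trans (Category.assoc _ _ _).symm)
      ((Category.id_comp _).trans (Category.comp_id _).symm)
    exact this.trans (Ext.mk₀_id_comp _)
  have h₂ : (D'.cls (n + 1) : Ext.{w} X (D.Z n) (n + 1)) =
      ((D'.ses 0).cls : Ext.{w} X (D.Z 0) 1).comp (D.cls n) (add_comm 1 n) :=
    iterClass_succ D'.Z (fun k => (D'.ses k).cls) n
  have h₃ : (Ext.mk₀ (𝟙 X ≫ 𝟙 X)).comp (hS.cls.comp x (add_comm 1 n)) (zero_add (n + 1)) =
      hS.cls.comp x (add_comm 1 n) := by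
    rw [Category.comp_id, Ext.mk₀_id_comp]
  exact h₃.trans ((comp_eq_comp_of_comp_mk₀_eq h₁ hx).trans
    (congrArg (fun y => y.comp (Ext.mk₀ b) (add_zero (n + 1))) h₂.symm))

lemma comp_comp_eq_of_mk₀_comp_eq {X Z W T Y : A} {e₀ : Ext.{w} W Z 1} {e : Ext.{w} X Z 1}
    {t : W ⟶ X} [IsIso t] (h : e₀ = (Ext.mk₀ t).comp e (zero_add 1)) {c : Ext.{w} Z T n} {b : T ⟶ Y}
    {x : Ext.{w} X Y (n + 1)} (hx : (Ext.mk₀ t).comp x (zero_add (n + 1)) =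
      (e₀.comp c (add_comm 1 n)).comp (Ext.mk₀ b) (add_zero (n + 1))) :
    e.comp (c.comp (Ext.mk₀ b) (add_zero n)) (add_comm 1 n) = x := by
  apply eq_of_mk₀_comp_eq t
  rw [hx, h, Ext.comp_assoc_of_third_deg_zero, Ext.comp_assoc _ _ _ (zero_add 1) (add_comm 1 n) (by omega)]

/-- An exact sequence decomposes into a conflation and a shorter exact sequence. -/
lemma exists_tail {ξ : NExtension E (n + 1) X Y} {x : Ext.{w} X Y (n + 1)} (hx : ξ.HasClass x) :
    ∃ (Z F : A) (i : Z ⟶ F) (p : F ⟶ X) (hS : SES i p) (ω : NExtension E n Z Y) (y : Ext.{w} Z Y n),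
      E Z ∧ E F ∧ ω.HasClass y ∧ hS.cls.comp y (add_comm 1 n) = x ∧
      ∀ {X' Z' F' : A} (i' : Z' ⟶ F') (p' : F' ⟶ X') (hS' : SES i' p') (hF' : E F') (hX' : E X')
        (a : Z' ⟶ Z) (b : F' ⟶ F) (c : X' ⟶ X) (η : NExtension E n Z' Y),
        i' ≫ b = a ≫ i → b ≫ p = p' ≫ c → MapsOver a η ω →
          MapsOver c (η.cons hS' hF' hX') ξ := by
  obtain ⟨D, b, hb, hx⟩ := hx
  have := D.isIso
  -- The tail has the cycles `D.Z 1` in degree 0, followed by the terms of `ξ` from degree 2 on.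
  let K' : ChainComplex A ℕ := (ChainComplex.truncate.obj (ChainComplex.truncate.obj ξ.K)).augment
    (D.p 1 : ξ.K.X 2 ⟶ D.Z 1) (by
      have := D.mono_j 1
      have h : ξ.K.d 3 2 ≫ D.p 1 = 0 := by
        rw [← cancel_mono (D.j 1), Category.assoc, zero_comp, ← D.fac, ξ.K.d_comp_d]
      exact h)
  let D' : AcyclicData E K' :=
    { Z := fun k => D.Z (k + 1)
      j := fun k => match k with
        | 0 => 𝟙 _
        | k + 1 => D.j (k + 2)
      p := fun k => D.p (k + 1)
      isIso := inferInstanceAs (IsIso (𝟙 (D.Z 1)))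
      fac := fun k => match k with
        | 0 => (Category.comp_id _).symm
        | k + 1 => D.fac (k + 2)
      ses := fun k => D.ses (k + 1)
      mem := fun k => D.mem (k + 1)
      mem_X := fun k => D.mem_X (k + 1) }
  let ω : NExtension E n (D.Z 1) Y :=
    { K := K'
      right := Iso.refl _
      left := ξ.left
      isZero := fun k hk => match k with
        | 0 => by omega
        | k + 1 => ξ.isZero (k + 2) (by omega)
      acyclic := AcyclicData.nonempty_iff.2 ⟨D'⟩ }
  have hS : SES (D.j 1) (D.p 0 ≫ D.j 0 ≫ ξ.right.hom) :=
    (D.ses 0).of_iso (Iso.refl _) (Iso.refl _) (asIso (D.j 0 ≫ ξ.right.hom)) (by simp) (by simp)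
  have h₁ : ((D.ses 0).cls : Ext.{w} _ _ 1) =
      (Ext.mk₀ (D.j 0 ≫ ξ.right.hom)).comp hS.cls (zero_add 1) := by
    simpa using (D.ses 0).cls_naturality.{w} hS (a := 𝟙 _) (b := 𝟙 _) (c := D.j 0 ≫ ξ.right.hom)
      (by simp) (by simp)
  have h₂ : (D.cls (n + 1) : Ext.{w} _ _ (n + 1)) =
      (D.ses 0).cls.comp (D'.cls n : Ext.{w} (D.Z 1) (D.Z (n + 1)) n) (add_comm 1 n) :=
    iterClass_succ D.Z (fun k => (D.ses k).cls) n
  refine ⟨D.Z 1, ξ.K.X 1, D.j 1, _, hS, ω,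
    (D'.cls n : Ext.{w} (D.Z 1) (D.Z (n + 1)) n).comp (Ext.mk₀ b) (add_zero n), D.mem _, D.mem_X 0,
    ⟨D', b, hb, ?_⟩, ?_, ?_⟩
  · have h : ∀ y : Ext.{w} (D.Z 1) Y n, (Ext.mk₀ (𝟙 (D.Z 1) ≫ 𝟙 (D.Z 1))).comp y (zero_add n) = y := by
      simp
    exact h _
  · exact comp_comp_eq_of_mk₀_comp_eq h₁
      (hx.trans (congrArg (fun y => y.comp (Ext.mk₀ b) (add_zero (n + 1))) h₂))
  · rintro X' Z' F' i' p' hS' hF' hX' a b c η h₃ h₄ ⟨φ, hφ, hφ'⟩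
    replace hφ : φ.f 0 = η.right.hom ≫ a := (Category.comp_id _).symm.trans hφ
    have h₅ : φ.f 1 ≫ D.p 1 = η.K.d 1 0 ≫ φ.f 0 := φ.comm 1 0
    refine ⟨{ f := fun k => match k with
                | 0 => c ≫ ξ.right.inv
                | 1 => b
                | k + 2 => φ.f (k + 1)
              comm' := ?_ }, ?_, hφ'⟩
    · rintro k l (rfl : l + 1 = k)
      match l with
      | 0 =>
        change b ≫ ξ.K.d 1 0 = p' ≫ c ≫ ξ.right.inv
        rw [← reassoc_of% h₄, D.fac]
        simp
      | 1 =>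
        change φ.f 1 ≫ ξ.K.d 2 1 = (η.K.d 1 0 ≫ η.right.hom ≫ i') ≫ b
        have h₆ : φ.f 1 ≫ D.p 1 = η.K.d 1 0 ≫ η.right.hom ≫ a := h₅.trans (congrArg _ hφ)
        have h₇ : φ.f 1 ≫ D.p 1 ≫ D.j 1 = η.K.d 1 0 ≫ η.right.hom ≫ a ≫ D.j 1 :=
          (Category.assoc _ _ _).symm.trans ((congrArg (· ≫ D.j 1) h₆).trans (by simp))
        exact (congrArg (φ.f 1 ≫ ·) (D.fac 1)).trans (h₇.trans (by simp [h₃]))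
      | l + 2 => exact φ.comm (l + 2) (l + 1)
    · change (c ≫ ξ.right.inv) ≫ ξ.right.hom = 𝟙 X' ≫ c
      simp

/-- Without middle terms an exact sequence is an isomorphism of Y with X, and its class is the
inverse. This is the base case of the comparison with Yoneda Ext. -/
lemma isIso_of_hasClass_mk₀ {ξ : NExtension E 0 X Y} {c : X ⟶ Y}
    (h : ξ.HasClass (Ext.mk₀ c : Ext.{w} X Y 0)) : IsIso c := by
  obtain ⟨D, b, hb, h⟩ := h
  have := D.isIso
  rw [Ext.mk₀_comp_mk₀, AcyclicData.cls_zero, Ext.mk₀_id_comp] at h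
  replace h := (Ext.mk₀_bijective _ _).1 h
  have : IsIso (D.p 0) := ξ.isIso_p D
  have hb' : b = inv (D.p 0) ≫ ξ.left.hom := by simp [← hb]
  have : IsIso ((D.j 0 ≫ ξ.right.hom) ≫ c) := by rw [h, hb']; infer_instance
  exact IsIso.of_isIso_comp_left (D.j 0 ≫ ξ.right.hom) c

lemma mapsOver_of_length_zero {X' : A} {ξ : NExtension E 0 X Y} {ζ : NExtension E 0 X' Y}
    {c : X ⟶ Y} {c' : X' ⟶ Y} (h : ξ.HasClass (Ext.mk₀ c : Ext.{w} X Y 0))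
    (h' : ζ.HasClass (Ext.mk₀ c' : Ext.{w} X' Y 0)) {t : X ⟶ X'} (ht : t ≫ c' = c) :
    MapsOver t ξ ζ := by
  have := isIso_of_hasClass_mk₀ h'
  obtain ⟨D, b, hb, h⟩ := h
  obtain ⟨D', b', hb', h'⟩ := h'
  rw [Ext.mk₀_comp_mk₀, AcyclicData.cls_zero, Ext.mk₀_id_comp] at h h'
  replace h := (Ext.mk₀_bijective _ _).1 h
  replace h' := (Ext.mk₀_bijective _ _).1 h'
  have h₁ : ξ.K.d 1 0 ≫ ξ.right.hom ≫ c = ξ.left.hom := by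
    rw [D.fac, ← hb, ← h]; simp
  have h₂ : ζ.K.d 1 0 ≫ ζ.right.hom ≫ c' = ζ.left.hom := by
    rw [D'.fac, ← hb', ← h']; simp
  refine ⟨{ f := fun k => match k with
              | 0 => ξ.right.hom ≫ t ≫ ζ.right.inv
              | 1 => ξ.left.hom ≫ ζ.left.inv
              | k + 2 => 0
            comm' := ?_ }, ?_, ?_⟩
  · rintro k l (rfl : l + 1 = k)
    match l with
    | 0 =>
      change (ξ.left.hom ≫ ζ.left.inv) ≫ ζ.K.d 1 0 = ξ.K.d 1 0 ≫ ξ.right.hom ≫ t ≫ ζ.right.inv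
      rw [← cancel_mono (ζ.right.hom ≫ c')]
      simp [h₁, h₂, ht]
    | 1 => exact (ξ.isZero 2 (by omega)).eq_of_src _ _
    | l + 2 => exact (ξ.isZero (l + 3) (by omega)).eq_of_src _ _
  · change (ξ.right.hom ≫ t ≫ ζ.right.inv) ≫ ζ.right.hom = _
    simp
  · change (ξ.left.hom ≫ ζ.left.inv) ≫ ζ.left.hom = _
    simp

/-- The exact sequence `0 ⟶ Y ⟶ Y ⟶ 0`. -/
lemma exists_hasClass_mk₀_id (hE : ∀ X, IsZero X → E X) (hY : E Y) :
    ∃ ω : NExtension E 0 Y Y, ω.HasClass (Ext.mk₀ (𝟙 Y) : Ext.{w} Y Y 0) := by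
  obtain ⟨O, h₀⟩ : ∃ O : A, IsZero O := ⟨_, isZero_zero A⟩
  let K₀ : ChainComplex A ℕ := { X := fun _ => O, d := fun _ _ => 0 }
  let K : ChainComplex A ℕ := (K₀.augment (0 : O ⟶ Y) (h₀.eq_of_src _ _)).augment (𝟙 Y)
    (h₀.eq_of_src _ _)
  let D : AcyclicData E K :=
    { Z := fun k => match k with
        | 0 => Y
        | k + 1 => O
      j := fun k => match k with
        | 0 => 𝟙 Y
        | k + 1 => 0
      p := fun k => match k with
        | 0 => 𝟙 Y
        | k + 1 => 0
      isIso := inferInstanceAs (IsIso (𝟙 Y))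
      fac := fun k => match k with
        | 0 => (Category.comp_id _).symm
        | 1 => h₀.eq_of_src _ _
        | k + 2 => h₀.eq_of_src _ _
      ses := fun k => match k with
        | 0 => SES.of_isIso (inferInstanceAs (IsIso (𝟙 Y))) h₀
        | k + 1 => SES.of_isIso ⟨0, h₀.eq_of_src _ _, h₀.eq_of_src _ _⟩ h₀
      mem := fun k => match k with
        | 0 => hY
        | k + 1 => hE _ h₀
      mem_X := fun k => match k with
        | 0 => hY
        | k + 1 => hE _ h₀ }
  refine ⟨{ K := K
            right := Iso.refl Y
            left := Iso.refl Y
            isZero := fun k hk => match k with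
              | 0 => by omega
              | 1 => by omega
              | k + 2 => h₀
            acyclic := AcyclicData.nonempty_iff.2 ⟨D⟩ }, D, 𝟙 Y, ?_, ?_⟩
  · exact Category.comp_id (𝟙 Y)
  · change (Ext.mk₀ (𝟙 Y ≫ 𝟙 Y)).comp _ _ = (Ext.mk₀ (𝟙 Y)).comp (Ext.mk₀ (𝟙 Y)) _
    simp

end Cons

end NExtension

end HigherTorsion

/-! ### Comparison of Yoneda Ext in `E` with Ext in the ambient category -/

namespace HigherTorsion

open Abelian

variable {A : Type u₁} [Category.{v₁} A] [Abelian A]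

lemma SES.prop_mid {E : ObjectProperty A} [E.IsClosedUnderExtensions] {K X Y : A} {i : K ⟶ X} {p : X ⟶ Y} (h : SES i p) (hK : E K) (hY : E Y) : E X :=
  E.prop_X₂_of_shortExact h.2 hK hY

variable [HasExt.{w} A]

/-- Every class in `Extⁱ(W, Y)` with `W` in `E` vanishes on some deflation `V ⟶ W` of `E`. -/
def Effaceable (E : ObjectProperty A) (i : ℕ) (Y : A) : Prop :=
  ∀ (W : A) (x : Ext.{w} W Y i), E W → ∃ (L V : A) (l : L ⟶ V) (p : V ⟶ W),
    SES l p ∧ E L ∧ E V ∧ (Ext.mk₀ p).comp x (zero_add i) = 0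

lemma effaceable_top (i : ℕ) (Y : A) : Effaceable.{w} (⊤ : ObjectProperty A) (i + 1) Y := by
  intro W x _
  obtain ⟨V, p, hp, h⟩ := Ext.exists_epi_comp_eq_zero x
  exact ⟨_, V, _, p, SES.of_epi p, trivial, trivial, h⟩

section

variable {E : ObjectProperty A} [E.IsClosedUnderExtensions]

namespace NExtension

/-- If the higher `Ext` into `Y` is effaceable in `E`, classes are represented by exact sequences
in `E`. -/
lemma exists_of_class (hE : ∀ X, IsZero X → E X) {Y : A} (hY : E Y) {n : ℕ}
    (hn : ∀ i, 1 ≤ i → i ≤ n + 1 → Effaceable.{w} E i Y) {X : A} (hX : E X)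
    (x : Ext.{w} X Y (n + 1)) : ∃ ξ : NExtension E (n + 1) X Y, ξ.HasClass x := by
  induction n generalizing X with
  | zero =>
    obtain ⟨L, V, l, p, h, hL, hV, h0⟩ := hn 1 le_rfl le_rfl X x hX
    obtain ⟨y, rfl⟩ := h.contra₃ x h0 (add_zero 1)
    obtain ⟨c, rfl⟩ := (Ext.mk₀_bijective _ _).2 y
    -- In degree 1 the class is the pushout of the effacing conflation along `c`.
    obtain ⟨F, j, q, g, hF, h₁, h₂⟩ := h.exists_pushout c
    obtain ⟨ω, hω⟩ := exists_hasClass_mk₀_id.{w} hE hY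
    have H := hω.cons hF (hF.prop_mid hY hX) hX
    rw [Ext.comp_mk₀_id] at H
    have h₃ := h.cls_naturality.{w} hF (c := 𝟙 X) h₁ (by rw [h₂, Category.comp_id])
    rw [Ext.mk₀_id_comp] at h₃
    exact ⟨_, h₃ ▸ H⟩
  | succ n ih =>
    obtain ⟨L, V, l, p, h, hL, hV, h0⟩ := hn (n + 2) (by omega) (by omega) X x hX
    -- A class killed by a deflation is the product of the class of its conflation with a class on
    -- the kernel, where the induction hypothesis applies.
    obtain ⟨y, rfl⟩ := h.contra₃ x h0 (add_comm 1 (n + 1))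
    obtain ⟨ξ, hξ⟩ := ih (fun i hi hi' => hn i hi (by omega)) hL y
    exact ⟨_, hξ.cons h hV hX⟩

/-- If the lower `Ext` into `Y` are effaceable in `E`, two exact sequences with classes that agree
over `W` receive morphisms from a common exact sequence over `W`. -/
lemma exists_mapsOver {Y : A} {n : ℕ}
    (hn : ∀ i, 1 ≤ i → i ≤ n → Effaceable.{w} E i Y) {W X X' : A} (hW : E W)
    (f : W ⟶ X) (f' : W ⟶ X') {ξ : NExtension E (n + 1) X Y} {ζ : NExtension E (n + 1) X' Y}
    {x : Ext.{w} X Y (n + 1)} {y : Ext.{w} X' Y (n + 1)} (hx : ξ.HasClass x) (hy : ζ.HasClass y)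
    (hxy : (Ext.mk₀ f).comp x (zero_add _) = (Ext.mk₀ f').comp y (zero_add _)) :
    ∃ η : NExtension E (n + 1) W Y, MapsOver f η ξ ∧ MapsOver f' η ζ := by
  induction n generalizing W X X' with
  | zero =>
    obtain ⟨Z, F, i, p, hS, ω, c, hZ, hF, hω, rfl, hξ⟩ := exists_tail hx
    obtain ⟨Z', F', i', p', hS', ω', c', hZ', hF', hω', rfl, hζ⟩ := exists_tail hy
    obtain ⟨c, rfl⟩ := (Ext.mk₀_bijective _ _).2 c
    obtain ⟨c', rfl⟩ := (Ext.mk₀_bijective _ _).2 c'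
    obtain ⟨P, j, q, g, hP, hjg, hgp, -⟩ := hS.exists_pullback f
    have := isIso_of_hasClass_mk₀ hω'
    have hPc : (hP.cls : Ext.{w} _ _ 1) = (Ext.mk₀ f).comp hS.cls (zero_add 1) := by
      simpa using hP.cls_naturality.{w} hS (a := 𝟙 Z) (by simpa using hjg) hgp
    obtain ⟨b, hb₁, hb₂⟩ := hP.exists_hom_of_cls_eq.{w} hS' (c ≫ inv c') f' (by
      rw [← Ext.mk₀_comp_mk₀, ← Ext.comp_assoc_of_third_deg_zero, hPc,
        Ext.comp_assoc_of_third_deg_zero (Ext.mk₀ f), hxy]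
      simp [Ext.comp_assoc_of_third_deg_zero])
    exact ⟨ω.cons hP (hP.prop_mid hZ hW) hW,
      hξ j q hP _ hW (𝟙 Z) g f ω (by simpa using hjg) hgp
        (mapsOver_of_length_zero hω hω (by simp)),
      hζ j q hP _ hW (c ≫ inv c') b f' ω hb₁ hb₂
        (mapsOver_of_length_zero hω hω' (by simp))⟩
  | succ n ih =>
    obtain ⟨Z, F, i, p, hS, ω, c, hZ, hF, hω, rfl, hξ⟩ := exists_tail hx
    obtain ⟨Z', F', i', p', hS', ω', c', hZ', hF', hω', rfl, hζ⟩ := exists_tail hy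
    obtain ⟨P, j, q, g, hP, hjg, hgp, -⟩ := hS.exists_pullback f
    obtain ⟨P', j', q', g', hP', hjg', hgp', -⟩ := hS'.exists_pullback f'
    -- Q → W dominates both first conflations, and its kernel T maps to both tails. The two tail
    -- classes need not agree on T.
    obtain ⟨Q, k, r, s, hQ, hks, hsr, -⟩ := hP'.exists_pullback q
    have hEP : E P := hP.prop_mid hZ hW
    have hEQ : E Q := hQ.prop_mid hZ' hEP
    obtain ⟨T, t, a, b, hT, hab, hat, hbt⟩ := hP.exists_comp hQ
    have hET : E T := hab.prop_mid hZ' hZ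
    obtain ⟨b', hb'⟩ := hP'.exists_lift (t ≫ s) (by
      rw [Category.assoc, hsr, hT.zero])
    have h₁ := hT.cls_naturality.{w} hS (a := b) (b := r ≫ g) (c := f)
      (by rw [← reassoc_of% hbt, hjg]) (by rw [Category.assoc, hgp, Category.assoc])
    have h₂ := hT.cls_naturality.{w} hS' (a := b') (b := s ≫ g') (c := f')
      (by rw [← reassoc_of% hb', hjg']) (by rw [Category.assoc, hgp', reassoc_of% hsr, Category.assoc])
    -- Since the full classes agree over W, the difference of the tail classes on T is restricted
    -- from a class `e` on Q. A further deflation V → Q kills `e`, so the tails agree on the kernel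
    -- T' of V → W.
    obtain ⟨e, he⟩ := hT.contra₁ ((Ext.mk₀ b).comp c (zero_add _) - (Ext.mk₀ b').comp c' (zero_add _))
      (add_comm 1 (n + 1)) (by
        rw [sub_eq_add_neg, Ext.comp_add, Ext.comp_neg, ← Ext.comp_assoc_of_second_deg_zero, h₁,
          ← Ext.comp_assoc_of_second_deg_zero, h₂, Ext.comp_assoc _ _ _ (zero_add 1) (add_comm 1 (n + 1)) (by omega), hxy,
          Ext.comp_assoc _ _ _ (zero_add 1) (add_comm 1 (n + 1)) (by omega), add_neg_cancel])
    obtain ⟨L, V, l, v, hV, hL, hEV, hv⟩ := hn (n + 1) (by omega) le_rfl Q e hEQ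
    obtain ⟨T', t', a', u, hT', ha', -, hu⟩ := hT.exists_comp hV
    obtain ⟨η, hη, hη'⟩ := ih (fun i hi hi' => hn i hi (by omega)) (ha'.prop_mid hL hET)
      (u ≫ b) (u ≫ b') hω hω' (by
        rw [← sub_eq_zero]
        have := congrArg (fun z => (Ext.mk₀ u).comp z (zero_add _)) he
        simp only [Ext.mk₀_comp_mk₀_assoc, sub_eq_add_neg, Ext.comp_add, Ext.comp_neg] at this ⊢
        rw [← this, hu, ← Ext.mk₀_comp_mk₀_assoc, hv, Ext.comp_zero])
    have hVW : v ≫ r ≫ q = v ≫ s ≫ q' := by rw [hsr]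
    exact ⟨η.cons hT' hEV hW,
      hξ _ _ hT' hEV hW _ (v ≫ r ≫ g) f η
        (by rw [← reassoc_of% hu, ← reassoc_of% hbt, hjg, Category.assoc]) (by simp [hgp]) hη,
      hζ _ _ hT' hEV hW _ (v ≫ s ≫ g') f' η
        (by rw [← reassoc_of% hu, ← reassoc_of% hb', hjg', Category.assoc])
        (by simp [hgp', reassoc_of% hsr]) hη'⟩

end NExtension

/-- If `Ext` into `Y` is effaceable in `E`, Yoneda extensions in `E` vanish if and only if the
extension groups in the ambient category do. -/
lemma extVanishes_iff (hE : ∀ X, IsZero X → E X) {X Y : A} (hX : E X) (hY : E Y) {n : ℕ}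
    (hn : ∀ i, 1 ≤ i → i ≤ n + 1 → Effaceable.{w} E i Y) :
    ExtVanishes E (n + 1) X Y ↔ ∀ x : Ext.{w} X Y (n + 1), x = 0 := by
  constructor
  · intro h x
    obtain ⟨ξ, hξ⟩ := NExtension.exists_of_class hE hY hn hX x
    obtain ⟨ζ, hζ⟩ := NExtension.exists_of_class hE hY hn hX (0 : Ext.{w} X Y (n + 1))
    let c : YonedaExt E (n + 1) X Y → Ext.{w} X Y (n + 1) :=
      Quot.lift (fun ξ => ξ.exists_hasClass.choose) fun ξ ζ h =>
        ξ.exists_hasClass.choose_spec.eq_of_yonedaEquiv ζ.exists_hasClass.choose_spec h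
    have h₁ : c (Quot.mk _ ξ) = x := ξ.exists_hasClass.choose_spec.unique hξ
    have h₂ : c (Quot.mk _ ζ) = 0 := ζ.exists_hasClass.choose_spec.unique hζ
    rw [← h₁, ← h₂]
    exact congrArg c (h.allEq (Quot.mk _ ξ) (Quot.mk _ ζ))
  · intro h
    refine ⟨?_⟩
    rintro ⟨ξ⟩ ⟨ζ⟩
    obtain ⟨x, hx⟩ := ξ.exists_hasClass
    obtain ⟨y, hy⟩ := ζ.exists_hasClass
    obtain ⟨η, h₁, h₂⟩ := NExtension.exists_mapsOver (fun i hi hi' => hn i hi (by omega)) hX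
      (𝟙 X) (𝟙 X) hx hy (by rw [h x, h y])
    exact Quot.sound ⟨η, h₁.mapsTo, h₂.mapsTo⟩

end

lemma extVanishes_top_iff (n : ℕ) (hn : 0 < n) (X Y : A) :
    ExtVanishes (⊤ : ObjectProperty A) n X Y ↔ ∀ x : Ext.{w} X Y n, x = 0 := by
  obtain ⟨n, rfl⟩ := Nat.exists_eq_succ_of_ne_zero hn.ne'
  exact extVanishes_iff (E := ⊤) (fun _ _ => trivial) trivial trivial fun i hi _ => by
    obtain ⟨i, rfl⟩ := Nat.exists_eq_succ_of_ne_zero (Nat.one_le_iff_ne_zero.1 hi)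
    exact effaceable_top i Y

end HigherTorsion

/-! ### Resolutions, approximations and dimension shifting -/

namespace HigherTorsion

open Abelian

variable {A : Type u₁} [Category.{v₁} A] [Abelian A]

/-- Every morphism from an object of `M` to `Y` lifts along `p`. -/
def LiftsFrom (M : ObjectProperty A) {X Y : A} (p : X ⟶ Y) : Prop :=
  ∀ (N : A) (g : N ⟶ Y), M N → ∃ l, l ≫ p = g

/-- The objects with an exact sequence `0 ⟶ Vₖ ⟶ ⋯ ⟶ V₁ ⟶ X ⟶ 0` with `Vᵢ` in `P`. -/
def Res (P : ObjectProperty A) : ℕ → ObjectProperty A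
  | 0 => fun X => IsZero X
  | k + 1 => fun X => ∃ (K V : A) (i : K ⟶ V) (p : V ⟶ X), SES i p ∧ P V ∧ Res P k K

/-- The objects with an exact sequence `Vₖ ⟶ ⋯ ⟶ V₁ ⟶ X ⟶ 0` with `Vᵢ` in `P`. -/
def Pres (P : ObjectProperty A) : ℕ → ObjectProperty A
  | 0 => fun _ => True
  | k + 1 => fun X => ∃ (K V : A) (i : K ⟶ V) (p : V ⟶ X), SES i p ∧ P V ∧ Pres P k K

/-- The objects with an exact sequence `Vₖ ⟶ ⋯ ⟶ V₁ ⟶ X ⟶ 0` with `Vᵢ` in `P` that stays exact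
under `Hom(N, -)` for `N` in `M`. -/
def ApproxPres (M P : ObjectProperty A) : ℕ → ObjectProperty A
  | 0 => fun _ => True
  | k + 1 => fun X => ∃ (K V : A) (i : K ⟶ V) (p : V ⟶ X),
      SES i p ∧ P V ∧ LiftsFrom M p ∧ ApproxPres M P k K

/-- The objects with an exact sequence `0 ⟶ X ⟶ V₁ ⟶ ⋯ ⟶ Vₖ ⟶ 0` with `Vᵢ` in `P` that stays exact
under `Hom(-, T)` for `T` in `M`. -/
def Cores (M P : ObjectProperty A) : ℕ → ObjectProperty A
  | 0 => fun X => IsZero X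
  | k + 1 => fun X => ∃ (V C : A) (i : X ⟶ V) (p : V ⟶ C),
      SES i p ∧ P V ∧ (∀ (T : A) (g : X ⟶ T), M T → ∃ h, i ≫ h = g) ∧ Cores M P k C

variable {M P : ObjectProperty A}

lemma Res.succ (hP : ∃ O, IsZero O ∧ P O) {k : ℕ} {X : A} (h : Res P k X) : Res P (k + 1) X := by
  induction k generalizing X with
  | zero =>
    obtain ⟨O, hO, hO'⟩ := hP
    exact ⟨X, O, 0, 0, SES.of_isIso ⟨0, hO.eq_of_src _ _, IsZero.eq_of_src h _ _⟩ h, hO', h⟩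
  | succ k ih =>
    obtain ⟨K, V, i, p, hS, hV, hK⟩ := h
    exact ⟨K, V, i, p, hS, hV, ih hK⟩

lemma Res.of_le (hP : ∃ O, IsZero O ∧ P O) {k l : ℕ} (hkl : k ≤ l) {X : A} (h : Res P k X) :
    Res P l X := by
  induction l, hkl using Nat.le_induction with
  | base => exact h
  | succ l _ ih => exact ih.succ hP

lemma Res.of_iso {k : ℕ} {X Y : A} (h : Res P k X) (e : X ≅ Y) : Res P k Y := by
  cases k with
  | zero => exact IsZero.of_iso h e.symm
  | succ k =>
    obtain ⟨K, V, i, p, hS, hV, hK⟩ := h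
    exact ⟨K, V, i, p ≫ e.hom, hS.of_iso (Iso.refl _) (Iso.refl _) e (by simp) (by simp), hV, hK⟩

lemma Res.one_of_mem {X : A} (h : P X) : Res P 1 X := by
  exact ⟨_, X, 0, 𝟙 X, SES.of_isIso inferInstance (isZero_zero A), h, isZero_zero A⟩

lemma Res.of_mem (hP : ∃ O, IsZero O ∧ P O) {X : A} (h : P X) (k : ℕ) : Res P (k + 1) X := by
  induction k with
  | zero => exact Res.one_of_mem h
  | succ k ih => exact ih.succ hP

lemma ApproxPres.pred {k : ℕ} {X : A} (h : ApproxPres M P (k + 1) X) : ApproxPres M P k X := by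
  induction k generalizing X with
  | zero => trivial
  | succ k ih =>
    obtain ⟨K, V, i, p, hS, hV, hp, hK⟩ := h
    exact ⟨K, V, i, p, hS, hV, hp, ih hK⟩

lemma ApproxPres.pres {k : ℕ} {X : A} (h : ApproxPres M P k X) : Pres P k X := by
  induction k generalizing X with
  | zero => trivial
  | succ k ih =>
    obtain ⟨K, V, i, p, hS, hV, hp, hK⟩ := h
    exact ⟨K, V, i, p, hS, hV, ih hK⟩

lemma Pres.pred {k : ℕ} {X : A} (h : Pres P (k + 1) X) : Pres P k X := by
  induction k generalizing X with
  | zero => trivial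
  | succ k ih =>
    obtain ⟨K, V, i, p, hS, hV, hK⟩ := h
    exact ⟨K, V, i, p, hS, hV, ih hK⟩

lemma Pres.one {k : ℕ} {X : A} (h : Pres P (k + 1) X) : Pres P 1 X := by
  obtain ⟨K, V, i, p, hS, hV, -⟩ := h
  exact ⟨K, V, i, p, hS, hV, trivial⟩

lemma Res.pres {k : ℕ} {X : A} (h : Res P k X) : Pres P k X := by
  induction k generalizing X with
  | zero => trivial
  | succ k ih =>
    obtain ⟨K, V, i, p, hS, hV, hK⟩ := h
    exact ⟨K, V, i, p, hS, hV, ih hK⟩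

/-- The horseshoe lemma. -/
lemma SES.horseshoe {Y L K V W K₁ K₂ : A} {i : Y ⟶ L} {p : L ⟶ K} (h : SES i p)
    {i₁ : K₁ ⟶ V} {p₁ : V ⟶ Y} (h₁ : SES i₁ p₁) {i₂ : K₂ ⟶ W} {p₂ : W ⟶ K} (h₂ : SES i₂ p₂)
    (s : W ⟶ L) (hs : s ≫ p = p₂) (hl : LiftsFrom M p₁) :
    ∃ (T : A) (t : T ⟶ V ⊞ W) (a : K₁ ⟶ T) (b : T ⟶ K₂),
      SES t (biprod.desc (p₁ ≫ i) s) ∧ SES a b ∧ LiftsFrom M b := by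
  have := h.mono
  have := h₁.mono
  have := h₁.epi
  have := h₂.mono
  have := h₂.epi
  obtain ⟨κ, hκ⟩ := h.exists_lift (i₂ ≫ s) (by rw [Category.assoc, hs, h₂.zero])
  -- V ⊞ W → L is factored as V ⊞ W → Y ⊞ W → L; T is then an extension of the kernel K₂ of the
  -- second map by the kernel K₁ of the first.
  have hr : SES (biprod.lift (-κ) i₂) (biprod.desc i s) := by
    refine SES.mk' (by simp [hκ]) ⟨fun a b hab => ?_⟩ (Preadditive.epi_of_cancel_zero _ fun f hf => ?_)
      fun g hg => ?_
    · have := congrArg (· ≫ biprod.snd) hab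
      simpa [cancel_mono] using this
    · have hf₁ : i ≫ f = 0 := by simpa using congrArg (biprod.inl ≫ ·) hf
      have hf₂ : s ≫ f = 0 := by simpa using congrArg (biprod.inr ≫ ·) hf
      obtain ⟨k, rfl⟩ := h.exists_desc f hf₁
      rw [← Category.assoc, hs] at hf₂
      rw [(cancel_epi p₂).1 (hf₂.trans comp_zero.symm), comp_zero]
    · have hg' : (g ≫ biprod.fst) ≫ i + (g ≫ biprod.snd) ≫ s = 0 := by
        rw [← hg]
        simp [biprod.desc_eq]
      obtain ⟨k, hk⟩ := h₂.exists_lift (g ≫ biprod.snd) (by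
        rw [← hs, ← Category.assoc, eq_neg_of_add_eq_zero_right hg']
        simp [h.zero])
      refine ⟨k, biprod.hom_ext _ _ ?_ (by simp [hk])⟩
      rw [← cancel_mono i]
      simp only [Category.assoc, biprod.lift_fst, Preadditive.neg_comp, Preadditive.comp_neg, hκ]
      rw [← Category.assoc, hk, ← Category.assoc g, eq_neg_of_add_eq_zero_left hg']
  have hq : SES (i₁ ≫ biprod.inl) (biprod.map p₁ (𝟙 W)) := by
    refine SES.mk' (by simp [reassoc_of% h₁.zero]) inferInstance
      (Preadditive.epi_of_cancel_zero _ fun f hf => ?_) fun g hg => ?_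
    · apply biprod.hom_ext'
      · rw [← cancel_epi p₁]
        simpa using congrArg (biprod.inl ≫ ·) hf
      · simpa using congrArg (biprod.inr ≫ ·) hf
    · obtain ⟨k, hk⟩ := h₁.exists_lift (g ≫ biprod.fst) (by
        simpa using congrArg (· ≫ biprod.fst) hg)
      refine ⟨k, biprod.hom_ext _ _ (by simp [hk]) ?_⟩
      have := congrArg (· ≫ biprod.snd) hg
      simp only [Category.assoc, biprod.map_snd, Category.comp_id, zero_comp] at this
      simp [this]
  obtain ⟨T, t, a, b, hT, hab, -, hb⟩ := hr.exists_comp hq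
  have hmap : biprod.map p₁ (𝟙 W) ≫ biprod.desc i s = biprod.desc (p₁ ≫ i) s := by
    apply biprod.hom_ext' <;> simp
  refine ⟨T, t, a, b, hmap ▸ hT, hab, fun N g hN => ?_⟩
  -- A lift of -(g ≫ κ) to V supplies the first component of a map into V ⊞ W that lands in the
  -- kernel T.
  obtain ⟨l, hl⟩ := hl N (-(g ≫ κ)) hN
  obtain ⟨c, hc⟩ := hT.exists_lift (biprod.lift l (g ≫ i₂)) (by
    simp [biprod.desc_eq, reassoc_of% hl, hκ])
  refine ⟨c, ?_⟩
  rw [← cancel_mono i₂]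
  have := congrArg (· ≫ biprod.snd) hb
  simp only [Category.assoc, biprod.lift_snd, biprod.map_snd, Category.comp_id] at this
  rw [Category.assoc, this, reassoc_of% hc, biprod.lift_snd]

lemma SES.liftsFrom_desc {Y L K V W : A} {i : Y ⟶ L} {p : L ⟶ K} (h : SES i p)
    {p₁ : V ⟶ Y} {p₂ : W ⟶ K} (s : W ⟶ L) (hs : s ≫ p = p₂) (hl : LiftsFrom M p₁)
    (hl₂ : ∀ (N : A) (g : N ⟶ L), M N → ∃ l, l ≫ p₂ = g ≫ p) :
    LiftsFrom M (biprod.desc (p₁ ≫ i) s) := by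
  intro N g hN
  obtain ⟨l, hl'⟩ := hl₂ N g hN
  obtain ⟨k, hk⟩ := h.exists_lift (g - l ≫ s) (by simp [hs, hl'])
  obtain ⟨l', hl''⟩ := hl N k hN
  exact ⟨biprod.lift l' l, by simp [biprod.desc_eq, reassoc_of% hl'', hk]⟩

lemma ApproxPres.of_ses (hPM : P ≤ M) (hP : ∀ X Y, P X → P Y → P (X ⊞ Y)) {k : ℕ} {Y L K : A}
    {i : Y ⟶ L} {p : L ⟶ K} (h : SES i p) (hp : LiftsFrom M p) (hY : ApproxPres M P k Y)
    (hK : ApproxPres M P k K) : ApproxPres M P k L := by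
  induction k generalizing Y L K with
  | zero => trivial
  | succ k ih =>
    obtain ⟨K₁, V, i₁, p₁, h₁, hV, hl₁, hK₁⟩ := hY
    obtain ⟨K₂, W, i₂, p₂, h₂, hW, hl₂, hK₂⟩ := hK
    obtain ⟨s, hs⟩ := hp W p₂ (hPM _ hW)
    obtain ⟨T, t, a, b, hT, hab, hb⟩ := h.horseshoe h₁ h₂ s hs hl₁
    exact ⟨T, V ⊞ W, t, _, hT, hP _ _ hV hW,
      h.liftsFrom_desc s hs hl₁ fun N g hN => hl₂ N _ hN, ih hab hb hK₁ hK₂⟩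

/-- The composite V → Y → X is an approximation whose kernel is an extension of ker p by the syzygy
K of Y. As ker p is again a retract of Y, it is handled by induction at length one less. -/
lemma ApproxPres.of_retract (hPM : P ≤ M) (hP : ∀ X Y, P X → P Y → P (X ⊞ Y)) {k : ℕ} {X Y : A}
    (s : X ⟶ Y) (p : Y ⟶ X) (hsp : s ≫ p = 𝟙 X) (hY : ApproxPres M P k Y) :
    ApproxPres M P k X := by
  induction k generalizing X Y with
  | zero => trivial
  | succ k ih =>
    have hY' := hY.pred
    obtain ⟨K, V, i, q, hS, hV, hl, hK⟩ := hY
    have : IsSplitEpi p := ⟨⟨s, hsp⟩⟩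
    have hι : SES (kernel.ι p) p := SES.of_epi p
    obtain ⟨T, t, a, b, hT, hab, -, hb⟩ := hι.exists_comp hS
    obtain ⟨r, hr⟩ := hι.exists_lift (𝟙 Y - p ≫ s) (by simp [hsp])
    have hX' : ApproxPres M P k (kernel p) := ih (kernel.ι p) r (by
      rw [← cancel_mono (kernel.ι p), Category.assoc, hr]; simp) hY'
    refine ⟨T, V, t, q ≫ p, hT, hV, fun N g hN => ?_, ApproxPres.of_ses hPM hP hab (fun N g hN => ?_) hK hX'⟩
    · obtain ⟨l, hl⟩ := hl N (g ≫ s) hN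
      exact ⟨l, by rw [reassoc_of% hl, hsp, Category.comp_id]⟩
    · obtain ⟨l, hl⟩ := hl N (g ≫ kernel.ι p) hN
      obtain ⟨c, hc⟩ := hT.exists_lift l (by rw [reassoc_of% hl]; simp)
      exact ⟨c, by rw [← cancel_mono (kernel.ι p), Category.assoc, hb, reassoc_of% hc, hl]⟩

section

variable [HasExt.{w} A]

/-- `Extⁱ(N, V) = 0` for `0 < i < d`, `N` in `M` and `V` in `P`. -/
def Rigid (d : ℕ) (M P : ObjectProperty A) : Prop :=
  ∀ (N V : A), M N → P V → ∀ i, 0 < i → i < d → ∀ x : Ext.{w} N V i, x = 0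

variable {d : ℕ}

lemma Res.ext_eq_zero (hR : Rigid.{w} d M P) {k : ℕ} {X : A} (hX : Res P k X) {N : A} (hN : M N)
    {i : ℕ} (hi : 0 < i) (hik : i + k ≤ d) (x : Ext.{w} N X i) : x = 0 := by
  induction k generalizing X i with
  | zero =>
    rw [← Ext.comp_mk₀_id x, IsZero.eq_of_src hX (𝟙 X) 0, Ext.mk₀_zero, Ext.comp_zero]
  | succ k ih =>
    obtain ⟨K, V, j, p, hS, hV, hK⟩ := hX
    obtain ⟨y, rfl⟩ := hS.cov₃ x rfl (ih hK (by omega) (by omega) _)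
    rw [hR N V hN hV i hi (by omega) y, Ext.zero_comp]

lemma SES.liftsFrom {K X Y : A} {i : K ⟶ X} {p : X ⟶ Y} (h : SES i p)
    (hK : ∀ N, M N → ∀ x : Ext.{w} N K 1, x = 0) : LiftsFrom M p := fun N g hN =>
  (h.exists_lift_iff.{w} g).2 (hK N hN _)

/-- The first syzygy has a resolution of length d - 1, which forces Ext¹(N, K) = 0 and makes the
cover approximating. Padding by zero restores length d, so the argument repeats to any length `k`.
-/
lemma Res.approxPres (hR : Rigid.{w} d M P) (hP : ∃ O, IsZero O ∧ P O) (hd : 1 ≤ d) {X : A}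
    (hX : Res P d X) (k : ℕ) : ApproxPres M P k X := by
  obtain ⟨d, rfl⟩ := Nat.exists_eq_add_of_le' hd
  induction k generalizing X with
  | zero => trivial
  | succ k ih =>
    obtain ⟨K, V, i, p, hS, hV, hK⟩ := hX
    exact ⟨K, V, i, p, hS, hV, hS.liftsFrom.{w} fun N hN x =>
      hK.ext_eq_zero hR hN one_pos (by omega) x, ih (hK.succ hP)⟩

/-- Each syzygy gains one degree of vanishing: Ext¹ from M vanishes by the approximation property,
higher Ext by shifting. When `k` reaches 0 the object lies in M, hence in P by `hq`. For k = d - 1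
the vanishing hypothesis is empty. -/
lemma ApproxPres.res_of_ext_eq_zero (hR : Rigid.{w} d M P)
    (hM : ∀ X, (∀ N, M N → ∀ i, 0 < i → i < d → ∀ x : Ext.{w} N X i, x = 0) → M X)
    (hq : ∀ X, M X → Pres P 1 X → P X) {k : ℕ} (hk : k < d) {X : A}
    (hX : ApproxPres M P (k + 1) X)
    (hX' : ∀ N, M N → ∀ i, 0 < i → i + k < d → ∀ x : Ext.{w} N X i, x = 0) :
    Res P (k + 1) X := by
  induction k generalizing X with
  | zero => exact Res.one_of_mem (hq X (hM X hX') hX.pres)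
  | succ k ih =>
    obtain ⟨K, V, i, p, hS, hV, hl, hK⟩ := hX
    refine ⟨K, V, i, p, hS, hV, ih (by omega) hK fun N hN j hj hjk x => ?_⟩
    obtain ⟨j, rfl⟩ := Nat.exists_eq_succ_of_ne_zero hj.ne'
    obtain ⟨y, rfl⟩ := hS.cov₁ x (hR N V hN hV _ hj (by omega) _) rfl
    cases j with
    | zero =>
      obtain ⟨g, rfl⟩ := (Ext.mk₀_bijective _ _).2 y
      exact (hS.exists_lift_iff.{w} g).1 (hl N g hN)
    | succ j => rw [hX' N hN (j + 1) (by omega) (by omega) y, Ext.zero_comp]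

lemma ApproxPres.res (hR : Rigid.{w} d M P)
    (hM : ∀ X, (∀ N, M N → ∀ i, 0 < i → i < d → ∀ x : Ext.{w} N X i, x = 0) → M X)
    (hq : ∀ X, M X → Pres P 1 X → P X) (hd : 1 ≤ d) {X : A} (hX : ApproxPres M P d X) :
    Res P d X := by
  obtain ⟨d, rfl⟩ := Nat.exists_eq_add_of_le' hd
  exact hX.res_of_ext_eq_zero hR hM hq (by omega) fun N hN i hi hi' => by omega

/-- The iterated class of a resolution detects morphisms out of shifts of objects of `M`. -/
lemma Res.exists_detecting_class (hR : Rigid.{w} d M P) {j : ℕ} {X : A} (hX : Res P (j + 1) X) :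
    ∃ (V : A) (μ : Ext.{w} X V j), P V ∧ ∀ N, M N → ∀ i, 0 < i → ∀ n (h : i + j = n), n ≤ d →
      ∀ y : Ext.{w} N X i, y.comp μ h = 0 → y = 0 := by
  induction j generalizing X with
  | zero =>
    obtain ⟨K, V, i, p, hS, hV, hK⟩ := hX
    have := hS.isIso_of_isZero_left hK
    refine ⟨V, Ext.mk₀ (inv p), hV, fun N hN i hi n h hn y hy => ?_⟩
    obtain rfl : i = n := h
    have := congrArg (fun z => z.comp (Ext.mk₀ p) (add_zero i)) hy
    simpa [Ext.comp_assoc_of_third_deg_zero] using this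
  | succ j ih =>
    obtain ⟨K, V, i, p, hS, hV, hK⟩ := hX
    obtain ⟨W, μ, hW, hμ⟩ := ih hK
    refine ⟨W, hS.cls.comp μ (add_comm 1 j), hW, fun N hN i hi n h hn y hy => ?_⟩
    rw [← Ext.comp_assoc _ _ _ rfl (add_comm 1 j) (by omega)] at hy
    -- By induction the class on the syzygy detects the connecting image of `y`, so `y` comes from
    -- Extⁱ(N, V) = 0.
    obtain ⟨z, rfl⟩ := hS.cov₃ y rfl (hμ N hN (i + 1) (by omega) n (by omega) hn _ hy)
    rw [hR N V hN hV i hi (by omega) z, Ext.zero_comp]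

/-- Extensions from a presented object to an object of `M` factor through an object of `P`. -/
lemma Pres.exists_factorization (hR : Rigid.{w} d P M)
    (hc : ∀ X, Pres P 1 X → ∃ (V : A) (i : X ⟶ V), P V ∧
      ∀ (T : A) (g : X ⟶ T), M T → ∃ h, i ≫ h = g) {j : ℕ} (hj : j < d) {X : A}
    (hX : Pres P (j + 1) X) {N : A} (hN : M N) (μ : Ext.{w} X N j) :
    ∃ (V : A) (h : V ⟶ N) (α : Ext.{w} X V j), P V ∧ α.comp (Ext.mk₀ h) (add_zero j) = μ := by
  induction j generalizing X with
  | zero =>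
    obtain ⟨V, i, hV, hi⟩ := hc X hX
    obtain ⟨g, rfl⟩ := (Ext.mk₀_bijective _ _).2 μ
    obtain ⟨h, hh⟩ := hi N g hN
    exact ⟨V, h, Ext.mk₀ i, hV, by rw [Ext.mk₀_comp_mk₀, hh]⟩
  | succ j ih =>
    obtain ⟨K, V, i, p, hS, hV, hK⟩ := hX
    -- Rigidity moves the class to the syzygy in one degree less; in degree 0 it is a morphism,
    -- which factors through a left approximation.
    obtain ⟨y, rfl⟩ := hS.contra₃ μ (hR V N hV hN (j + 1) (by omega) hj _) (add_comm 1 j)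
    obtain ⟨W, h, α, hW, rfl⟩ := ih (by omega) hK y
    exact ⟨W, h, hS.cls.comp α (add_comm 1 j), hW, Ext.comp_assoc_of_third_deg_zero _ _ _ _⟩

end

end HigherTorsion

/-! ### Extension closure and cluster tilting of the resolved objects -/

namespace HigherTorsion

open Abelian

variable {A : Type u₁} [Category.{v₁} A] [Abelian A] [HasExt.{w} A]

lemma Cores.ext_eq_zero {d k : ℕ} {M U : ObjectProperty A} {C X : A} (hC : Cores M U k C)
    (hX : ∀ N, U N → ∀ i, 0 < i → i < d → ∀ x : Ext.{w} N X i, x = 0) {i : ℕ} (hi : 0 < i)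
    (hik : i + k ≤ d) (x : Ext.{w} C X i) : x = 0 := by
  induction k generalizing C i with
  | zero => rw [← Ext.mk₀_id_comp x, IsZero.eq_of_src hC (𝟙 C) 0, Ext.mk₀_zero, Ext.zero_comp]
  | succ k ih =>
    obtain ⟨V, C', j, p, hS, hV, -, hC'⟩ := hC
    obtain ⟨y, rfl⟩ := hS.contra₁ x (add_comm 1 i) (ih hC' (by omega) (by omega) _)
    rw [hX V hV i hi (by omega) y, Ext.comp_zero]

/-- The properties of a `d`-torsion class `U` of a `d`-cluster tilting subcategory `M`, expressed in
terms of extension groups, that the study of the objects with a resolution in `U` relies on. -/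
structure TorsionSetup (d : ℕ) (M U : ObjectProperty A) : Prop where
  pos : 1 ≤ d
  le : U ≤ M
  zero : ∃ O, IsZero O ∧ U O
  biprod : ∀ X Y, U X → U Y → U (X ⊞ Y)
  retract : ∀ {X Y : A} (s : X ⟶ Y) (p : Y ⟶ X), s ≫ p = 𝟙 X → U Y → U X
  rigid : Rigid.{w} d M M
  mem : ∀ X, (∀ N, M N → ∀ i, 0 < i → i < d → ∀ x : Ext.{w} N X i, x = 0) → M X
  cover : ∀ X, ∃ (N : A) (p : N ⟶ X), M N ∧ Epi p ∧ LiftsFrom M p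
  cores : ∀ X, Pres U 1 X → Cores M U d X
  extension : ∀ (K V : A), U K → U V → ∀ γ : Ext.{w} K V d,
    ∃ (Y W : A) (i : Y ⟶ W) (p : W ⟶ K), SES i p ∧ U W ∧ Res U d Y ∧
      ∀ (N : A) (g : N ⟶ K), M N → ((Ext.mk₀ g).comp γ (zero_add d) = 0 ↔ ∃ l, l ≫ p = g)

namespace TorsionSetup

variable {d : ℕ} {M U : ObjectProperty A} (h : TorsionSetup.{w} d M U)

include h

lemma rigid_left : Rigid.{w} d M U := fun N V hN hV => h.rigid N V hN (h.le _ hV)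

lemma rigid_right : Rigid.{w} d U M := fun N V hN hV => h.rigid N V (h.le _ hN) hV

/-- The identity of X factors through the left M-approximation X → V, so X is a summand of V. -/
lemma mem_of_pres_one (X : A) (hX : M X) (hX' : Pres U 1 X) : U X := by
  obtain ⟨d, rfl⟩ := Nat.exists_eq_add_of_le' h.pos
  obtain ⟨V, C, i, p, hS, hV, hi, -⟩ := h.cores X hX'
  obtain ⟨r, hr⟩ := hi X (𝟙 X) hX
  exact h.retract i r hr hV

lemma res_of_approxPres {X : A} (hX : ApproxPres M U d X) : Res U d X :=
  hX.res h.rigid_left h.mem h.mem_of_pres_one h.pos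

lemma approxPres {X : A} (hX : Res U d X) (k : ℕ) : ApproxPres M U k X :=
  hX.approxPres h.rigid_left h.zero h.pos k

lemma approxPres_self (X : A) (k : ℕ) : ApproxPres M M k X := by
  induction k generalizing X with
  | zero => trivial
  | succ k ih =>
    obtain ⟨N, p, hN, hp, hl⟩ := h.cover X
    exact ⟨_, N, _, p, SES.of_epi p, hN, hl, ih _⟩

lemma res_self (X : A) : Res M d X :=
  (h.approxPres_self X d).res h.rigid h.mem (fun _ hX _ => hX) h.pos

lemma exists_cover {X : A} (hX : Res U d X) :
    ∃ (K V : A) (i : K ⟶ V) (p : V ⟶ X), SES i p ∧ U V ∧ LiftsFrom M p ∧ Res U d K := by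
  obtain ⟨d, rfl⟩ := Nat.exists_eq_add_of_le' h.pos
  obtain ⟨K, V, i, p, hS, hV, hK⟩ := hX
  exact ⟨K, V, i, p, hS, hV, hS.liftsFrom.{w} fun N hN x =>
    hK.ext_eq_zero h.rigid_left hN one_pos (by omega) x, hK.succ h.zero⟩

/-- An extension of an object of `U` by an object with a `U`-resolution has a `U`-resolution. -/
lemma res_of_ses_of_mem {Y L K : A} {i : Y ⟶ L} {p : L ⟶ K} (hS : SES i p) (hY : Res U d Y)
    (hK : U K) : Res U d L := by
  apply h.res_of_approxPres
  obtain ⟨d, rfl⟩ := Nat.exists_eq_add_of_le' h.pos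
  obtain ⟨V₀, μ, hV₀, hμ⟩ := hY.exists_detecting_class h.rigid_left
  obtain ⟨Y', W, i', p', hS', hW, hY', hg⟩ :=
    h.extension K V₀ hK hV₀ (hS.cls.comp μ (add_comm 1 d))
  have hassoc : ∀ {N : A} (g : N ⟶ K), (Ext.mk₀ g).comp (hS.cls.comp μ (add_comm 1 d)) (zero_add _) =
      ((Ext.mk₀ g).comp hS.cls (zero_add 1)).comp μ (add_comm 1 d) := fun g =>
    (Ext.comp_assoc _ _ _ (zero_add 1) (add_comm 1 d) (by omega)).symm
  -- `p'` lifts along itself, so it kills the product of the extension class with `μ`; by detection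
  -- it kills the extension class, and therefore lifts to L.
  obtain ⟨s, hs⟩ := (hS.exists_lift_iff.{w} p').2 (hμ W (h.le _ hW) 1 one_pos (d + 1) (add_comm 1 d)
    le_rfl _ (by rw [← hassoc]; exact (hg W p' (h.le _ hW)).2 ⟨𝟙 W, Category.id_comp _⟩))
  obtain ⟨K₁, V, i₁, p₁, h₁, hV, hl, hK₁⟩ := h.approxPres hY (d + 1)
  obtain ⟨T, t, a, b, hT, hab, hb⟩ := hS.horseshoe h₁ hS' s hs hl
  refine ⟨T, V ⊞ W, t, _, hT, h.biprod _ _ hV hW, hS.liftsFrom_desc s hs hl fun N g hN => ?_,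
    ApproxPres.of_ses h.le h.biprod hab hb hK₁ (h.approxPres hY' d)⟩
  rw [← hg N _ hN, hassoc, (hS.exists_lift_iff _).1 ⟨g, rfl⟩, Ext.zero_comp]

/-- Pulling back along the first cover V → K gives an extension F of V by Y, settled by
`res_of_ses_of_mem`. Covering F by W in U covers L, with kernel an extension of the syzygy of K by
an object of U_d(A); its right end has a shorter resolution. -/
lemma res_of_ses_of_res {k : ℕ} (hk : k ≤ d) {Y L K : A} {i : Y ⟶ L} {p : L ⟶ K} (hS : SES i p)
    (hY : Res U d Y) (hK : Res U k K) : Res U d L := by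
  induction k generalizing Y L K with
  | zero =>
    have := hS.mono
    have := hS.epi
    have : Epi i := hS.2.exact.epi_f (IsZero.eq_of_tgt hK _ _)
    have := isIso_of_mono_of_epi i
    exact hY.of_iso (asIso i)
  | succ k ih =>
    obtain ⟨K₂, V, i₁, p₁, h₁, hV, hK₂⟩ := hK
    obtain ⟨F, j, q, j', g, hF, hF', -, hl⟩ := hS.exists_pullback₂ h₁
    obtain ⟨Y', W, i', p', hS', hW, hl', hY'⟩ := h.exists_cover (h.res_of_ses_of_mem hF hY hV)
    obtain ⟨T, t, a, b, hT, hab, -, -⟩ := hF'.exists_comp hS'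
    have hT' := ih (by omega) hab hY' hK₂
    have hl₁ : LiftsFrom M p₁ := h₁.liftsFrom.{w} fun N hN x =>
      hK₂.ext_eq_zero h.rigid_left hN one_pos (by omega) x
    apply h.res_of_approxPres
    obtain ⟨d, rfl⟩ := Nat.exists_eq_add_of_le' h.pos
    refine ⟨T, W, t, _, hT, hW, fun N g' hN => ?_, h.approxPres hT' d⟩
    obtain ⟨l, hl₂⟩ := hl₁ N (g' ≫ p) hN
    obtain ⟨c, hc, -⟩ := hl g' l hl₂.symm
    obtain ⟨c', hc'⟩ := hl' N c hN
    exact ⟨c', by rw [reassoc_of% hc', hc]⟩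

lemma isClosedUnderExtensions : (Res U d).IsClosedUnderExtensions where
  prop_X₂_of_shortExact hS h₁ h₃ := h.res_of_ses_of_res le_rfl (SES.of_shortExact hS) h₁ h₃

/-- A detecting class of X with values in M factors through some `α` with values in U. Realizing its
product with the extension class over a cover U₀ → C gives W → C with kernel T in U_d(A). The maps V
→ C and W → C factor through each other, so, as in Schanuel's lemma, X is a summand of T ⊞ V. -/
lemma res_of_cosyzygy {X V C : A} {i : X ⟶ V} {p : V ⟶ C} (hS : SES i p) (hV : U V)
    (hC : Res U d C) (hX : Pres U d X) : Res U d X := by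
  have := h.isClosedUnderExtensions
  have hd := h.pos
  have := hS.mono
  obtain ⟨e, rfl⟩ := Nat.exists_eq_add_of_le' h.pos
  obtain ⟨N₀, μ, hN₀, hμ⟩ := (h.res_self X).exists_detecting_class h.rigid
  obtain ⟨V₀, f, α, hV₀, rfl⟩ := hX.exists_factorization h.rigid_right (fun Z hZ => by
    obtain ⟨V, C, i, p, -, hV, hi, -⟩ := h.cores Z hZ
    exact ⟨V, i, hV, hi⟩) (by omega) hN₀ μ
  let γ : Ext.{w} C V₀ (e + 1) := hS.cls.comp α (add_comm 1 e)
  have hγ : ∀ {N : A} (g : N ⟶ C), ((Ext.mk₀ g).comp hS.cls (zero_add 1)).comp α (add_comm 1 e) =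
      (Ext.mk₀ g).comp γ (zero_add _) := fun g =>
    Ext.comp_assoc _ _ _ (zero_add 1) (add_comm 1 e) (by omega)
  obtain ⟨K, U₀, i₀, q₀, h₀, hU₀, hl₀, hK⟩ := h.exists_cover hC
  obtain ⟨Y, W, i', p', hS', hW, hY, hg⟩ :=
    h.extension U₀ V₀ hU₀ hV₀ ((Ext.mk₀ q₀).comp γ (zero_add _))
  obtain ⟨T, t, a, b, hT, hab, -, -⟩ := h₀.exists_comp hS'
  have hT' : Res U (e + 1) T := hab.prop_mid hY hK
  obtain ⟨x, hx⟩ := (hS.exists_lift_iff.{w} (p' ≫ q₀)).2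
    (hμ W (h.le _ hW) 1 one_pos (e + 1) (add_comm 1 e) le_rfl _ (by
      rw [← Ext.comp_assoc_of_third_deg_zero, hγ, ← Ext.mk₀_comp_mk₀_assoc,
        (hg W p' (h.le _ hW)).2 ⟨𝟙 W, Category.id_comp _⟩, Ext.zero_comp]))
  obtain ⟨g, hg'⟩ := hl₀ V p (h.le _ hV)
  obtain ⟨y, hy⟩ := (hg V g (h.le _ hV)).1 (by
    rw [Ext.mk₀_comp_mk₀_assoc, hg', ← hγ, hS.comp_cls, Ext.zero_comp])
  have hy' : y ≫ p' ≫ q₀ = p := by rw [reassoc_of% hy, hg']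
  obtain ⟨a', ha'⟩ := hT.exists_lift (i ≫ y) (by rw [Category.assoc, hy', hS.zero])
  obtain ⟨b', hb'⟩ := hS.exists_lift (t ≫ x) (by rw [Category.assoc, hx, hT.zero])
  obtain ⟨s, hs⟩ := hS.exists_lift (𝟙 V - y ≫ x) (by simp [hx, hy'])
  apply h.res_of_approxPres
  refine ApproxPres.of_retract h.le h.biprod (biprod.lift a' i) (biprod.desc b' s) ?_
    (h.approxPres ((Res U (e + 1)).prop_biprod hT' (Res.of_mem h.zero hV e)) _)
  rw [← cancel_mono i]
  simp [hb', hs, reassoc_of% ha']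

lemma res_of_mem {X : A} (hX : U X) : Res U d X :=
  (Res.one_of_mem hX).of_le h.zero h.pos

/-- Induction along the U-coresolution of X. Passing to the cokernel shortens the coresolution and
lengthens the presentation by one term, so d terms of presentation are always available; the
induction ends at a zero object. -/
lemma res_of_pres {X : A} (hX : Pres U d X) : Res U d X := by
  have key : ∀ (k : ℕ) (X : A), Cores M U k X → Pres U d X → Res U d X := by
    intro k
    induction k with
    | zero =>
      intro X hX _
      exact Res.of_le h.zero (Nat.zero_le d) (X := X) hX
    | succ k ih =>
      rintro X ⟨V, C, i, p, hS, hV, -, hC⟩ hX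
      have hC' : Pres U (d + 1) C := ⟨X, V, i, p, hS, hV, hX⟩
      exact h.res_of_cosyzygy hS hV (ih C hC hC'.pred) hX
  obtain ⟨d, rfl⟩ := Nat.exists_eq_add_of_le' h.pos
  exact key _ X (h.cores X hX.one) hX

/-- The objects with a `U`-resolution embed into `U`, with quotient of the same kind. -/
lemma exists_hull {X : A} (hX : Res U d X) :
    ∃ (V C : A) (i : X ⟶ V) (p : V ⟶ C), SES i p ∧ U V ∧
      (∀ (T : A) (g : X ⟶ T), M T → ∃ h, i ≫ h = g) ∧ Cores M U (d - 1) C ∧ Res U d C := by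
  have hX' := hX.pres
  obtain ⟨e, rfl⟩ := Nat.exists_eq_add_of_le' h.pos
  obtain ⟨V, C, i, p, hS, hV, hi, hC⟩ := h.cores X hX'.one
  have hC' : Pres U (e + 2) C := ⟨X, V, i, p, hS, hV, hX'⟩
  exact ⟨V, C, i, p, hS, hV, hi, hC, h.res_of_pres hC'.pred⟩

/-- Embedding Y into U with cokernel C in U_d(A) lowers the degree, since Ext from V into U
vanishes. In degree 1 the class comes from a map V → C, and the pullback along it is the required
deflation. -/
lemma exists_deflation_of_mem {i : ℕ} (hi : 0 < i) (hid : i < d) {V Y : A} (hV : U V)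
    (hY : Res U d Y) (x : Ext.{w} V Y i) : ∃ (L F : A) (l : L ⟶ F) (p : F ⟶ V),
      SES l p ∧ Res U d L ∧ Res U d F ∧ (Ext.mk₀ p).comp x (zero_add i) = 0 := by
  have := h.isClosedUnderExtensions
  induction i generalizing Y with
  | zero => omega
  | succ i ih =>
    obtain ⟨V', C, j, q, hS, hV', -, -, hC⟩ := h.exists_hull hY
    obtain ⟨y, rfl⟩ := hS.cov₁ x (h.rigid V V' (h.le _ hV) (h.le _ hV') _ hi hid _) rfl
    cases i with
    | zero =>
      obtain ⟨g, rfl⟩ := (Ext.mk₀_bijective _ _).2 y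
      obtain ⟨F, l, p, g', hF, -, hg', -⟩ := hS.exists_pullback g
      refine ⟨Y, F, l, p, hF, hY, hF.prop_mid hY (h.res_of_mem hV), ?_⟩
      rw [Ext.mk₀_comp_mk₀_assoc, ← hg', ← Ext.mk₀_comp_mk₀_assoc, hS.comp_cls, Ext.comp_zero]
    | succ i =>
      obtain ⟨L, F, l, p, hF, hL, hF', hp⟩ := ih (by omega) (by omega) hC y
      refine ⟨L, F, l, p, hF, hL, hF', ?_⟩
      rw [← Ext.comp_assoc _ _ _ (zero_add _) rfl (by omega), hp, Ext.zero_comp]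

lemma effaceable {i : ℕ} (hi : 0 < i) (hid : i < d) {Y : A} (hY : Res U d Y) :
    Effaceable.{w} (Res U d) i Y := by
  have := h.isClosedUnderExtensions
  intro W x hW
  obtain ⟨K, V, j, q, hS, hV, -, hK⟩ := h.exists_cover hW
  obtain ⟨L, F, l, p, hS', hL, hF, hp⟩ :=
    h.exists_deflation_of_mem hi hid hV hY ((Ext.mk₀ q).comp x (zero_add i))
  obtain ⟨T, t, a, b, hT, hab, -, -⟩ := hS.exists_comp hS'
  exact ⟨T, F, t, p ≫ q, hT, hab.prop_mid hL hK, hF, by rw [← Ext.mk₀_comp_mk₀_assoc, hp]⟩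

lemma extVanishes_iff {i : ℕ} (hi : 0 < i) (hid : i < d) {X Y : A} (hX : Res U d X)
    (hY : Res U d Y) : ExtVanishes (Res U d) i X Y ↔ ∀ x : Ext.{w} X Y i, x = 0 := by
  have := h.isClosedUnderExtensions
  obtain ⟨i, rfl⟩ := Nat.exists_eq_succ_of_ne_zero hi.ne'
  exact HigherTorsion.extVanishes_iff (fun X hX => Res.of_le h.zero (Nat.zero_le d) (X := X) hX) hX hY
    fun j hj hji => h.effaceable hj (by omega) hY

lemma mem_of_ext_right_eq_zero {X : A} (hX : Res U d X)
    (hX' : ∀ N, U N → ∀ i, 0 < i → i < d → ∀ x : Ext.{w} X N i, x = 0) : U X := by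
  obtain ⟨e, rfl⟩ := Nat.exists_eq_add_of_le' h.pos
  obtain ⟨K, V, i, p, hS, hV, hK⟩ := hX
  -- Dimension shifting is applied with X as the only test object: then Ext¹(X, K) = 0 and the cover
  -- of X splits.
  have hR : Rigid.{w} (e + 1) (fun Z => Z = X) U := by
    rintro _ N rfl hN
    exact hX' N hN
  obtain ⟨s, hs⟩ := hS.liftsFrom.{w} (M := fun Z => Z = X) (fun N hN x =>
    hK.ext_eq_zero hR hN one_pos (by omega) x) X (𝟙 X) rfl
  exact h.retract s p hs hV

/-- Shifting along the U-coresolution of the cokernel C gives Ext¹(C, X) = 0, so the hull X → V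
splits. -/
lemma mem_of_ext_left_eq_zero {X : A} (hX : Res U d X)
    (hX' : ∀ N, U N → ∀ i, 0 < i → i < d → ∀ x : Ext.{w} N X i, x = 0) : U X := by
  obtain ⟨V, C, i, p, hS, hV, -, hC, -⟩ := h.exists_hull hX
  have hd := h.pos
  obtain ⟨y, hy⟩ := hS.contra₁ (Ext.mk₀ (𝟙 X)) (add_zero 1)
    (hC.ext_eq_zero hX' one_pos (by omega) _)
  obtain ⟨r, rfl⟩ := (Ext.mk₀_bijective _ _).2 y
  rw [Ext.mk₀_comp_mk₀] at hy
  exact h.retract i r ((Ext.mk₀_bijective _ _).1 hy) hV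

lemma isClusterTilting : IsClusterTilting d (Res U d) U where
  le _ hX := h.res_of_mem hX
  generating X hX := by
    obtain ⟨K, V, i, p, hS, hV, -, hK⟩ := h.exists_cover hX
    exact ⟨V, p, hV, K, i, hS.zero, (conflation_mk_iff _).2 ⟨hS, hK, h.res_of_mem hV, hX⟩⟩
  cogenerating X hX := by
    obtain ⟨V, C, i, p, hS, hV, -, -, hC⟩ := h.exists_hull hX
    exact ⟨V, i, hV, C, p, hS.zero, (conflation_mk_iff _).2 ⟨hS, hX, h.res_of_mem hV, hC⟩⟩
  contravariantlyFinite X hX := by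
    obtain ⟨K, V, i, p, hS, hV, hl, hK⟩ := h.exists_cover hX
    exact ⟨V, p, hV, fun N g hN => hl N g (h.le _ hN)⟩
  covariantlyFinite X hX := by
    obtain ⟨V, C, i, p, hS, hV, hi, -, hC⟩ := h.exists_hull hX
    exact ⟨V, i, hV, fun N g hN => hi N g (h.le _ hN)⟩
  mem_iff_left X := by
    refine ⟨fun hX => ⟨h.res_of_mem hX, fun i hi hid N hN =>
      (h.extVanishes_iff hi hid (h.res_of_mem hX) (h.res_of_mem hN)).2
        (h.rigid X N (h.le _ hX) (h.le _ hN) i hi hid)⟩, fun ⟨hX, hX'⟩ => ?_⟩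
    exact h.mem_of_ext_right_eq_zero hX fun N hN i hi hid =>
      (h.extVanishes_iff hi hid hX (h.res_of_mem hN)).1 (hX' i hi hid N hN)
  mem_iff_right X := by
    refine ⟨fun hX => ⟨h.res_of_mem hX, fun i hi hid N hN =>
      (h.extVanishes_iff hi hid (h.res_of_mem hN) (h.res_of_mem hX)).2
        (h.rigid N X (h.le _ hN) (h.le _ hX) i hi hid)⟩, fun ⟨hX, hX'⟩ => ?_⟩
    exact h.mem_of_ext_left_eq_zero hX fun N hN i hi hid =>
      (h.extVanishes_iff hi hid (h.res_of_mem hN) hX).1 (hX' i hi hid N hN)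

end TorsionSetup

end HigherTorsion

/-! ### From the axioms of a d-torsion class to `TorsionSetup` -/

namespace HigherTorsion

open Abelian

variable {A : Type u₁} [Category.{v₁} A] [Abelian A]

lemma IsZero.acyclicData {E : ObjectProperty A} {X : A} (hX : IsZero X) (hE : E X) :
    ∃ K : ChainComplex A ℕ, Nonempty (AcyclicData E K) ∧ ∀ i, K.X i = X :=
  ⟨{ X := fun _ => X, d := fun _ _ => 0 }, ⟨
    { Z := fun _ => X
      j := fun _ => 0
      p := fun _ => 0
      isIso := ⟨0, hX.eq_of_src _ _, hX.eq_of_src _ _⟩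
      fac := fun _ => hX.eq_of_src _ _
      ses := fun _ => SES.of_isIso ⟨0, hX.eq_of_src _ _, hX.eq_of_src _ _⟩ hX
      mem := fun _ => hE
      mem_X := fun _ => hE }⟩, fun _ => rfl⟩

lemma Res.resolved {d : ℕ} {U : ObjectProperty A} {X : A} (hX : Res U d X) : resolved d ⊤ U X := by
  induction d generalizing X with
  | zero =>
    obtain ⟨K, hK, h⟩ := IsZero.acyclicData (E := ⊤) hX trivial
    exact ⟨K, AcyclicData.nonempty_iff.2 hK, ⟨eqToIso (h 0)⟩, fun i hi hi' => by omega,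
      fun i _ => (h i).symm ▸ hX⟩
  | succ d ih =>
    obtain ⟨Z, V, i, p, hS, hV, hZ⟩ := hX
    obtain ⟨K, hK, ⟨e⟩, hU, hK'⟩ := ih hZ
    obtain ⟨D⟩ := AcyclicData.nonempty_iff.1 hK
    refine ⟨_, AcyclicData.nonempty_iff.2 ⟨NExtension.spliceData D e hS trivial trivial⟩,
      ⟨Iso.refl X⟩, fun k hk hk' => ?_, fun k hk => ?_⟩
    · match k with
      | 0 => omega
      | 1 => exact hV
      | k + 2 => exact hU (k + 1) (by omega) (by omega)
    · match k with
      | 0 => omega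
      | 1 => omega
      | k + 2 => exact hK' (k + 1) (by omega)

lemma AcyclicData.res {E : ObjectProperty A} {K : ChainComplex A ℕ} (D : AcyclicData E K)
    {U : ObjectProperty A} {n : ℕ} (hK : IsZero (K.X (n + 1))) {k l : ℕ} (hkl : k + l = n)
    (hU : ∀ i, k + 1 ≤ i → i ≤ n → U (K.X i)) : Res U l (D.Z k) := by
  induction l generalizing k with
  | zero =>
    obtain rfl : k = n := hkl
    exact D.isZero_Z hK
  | succ l ih =>
    exact ⟨_, _, _, _, D.ses k, hU (k + 1) le_rfl (by omega),
      ih (by omega) fun i hi hi' => hU i (by omega) hi'⟩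

lemma resolved_eq_res (d : ℕ) (U : ObjectProperty A) : resolved d ⊤ U = Res U d := by
  ext X
  refine ⟨?_, Res.resolved⟩
  rintro ⟨K, hK, ⟨e⟩, hU, hK'⟩
  obtain ⟨D⟩ := AcyclicData.nonempty_iff.1 hK
  have := D.isIso
  exact (D.res (hK' (d + 1) (by omega)) (zero_add d) fun i hi hi' => hU i (by omega) hi').of_iso
    (asIso (D.j 0) ≪≫ e)

section Coresolution

variable {d : ℕ} {M : ObjectProperty A} {K : ChainComplex A ℕ}

/-- In a right `d`-exact sequence of a cogenerating subcategory, each cokernel embeds into the next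
term by a left approximation. -/
lemma IsRightDExact.exists_ses (hM : ∀ X, ∃ (N : A) (i : X ⟶ N), M N ∧ Mono i)
    (hK : IsRightDExact d M K) {i : ℕ} (hi : i < d) :
    ∃ (j : cokernel (K.d (i + 2) (i + 1)) ⟶ K.X i),
      cokernel.π (K.d (i + 2) (i + 1)) ≫ j = K.d (i + 1) i ∧ Mono j ∧
      ∀ (T : A) (g : cokernel (K.d (i + 2) (i + 1)) ⟶ T), M T → ∃ h, j ≫ h = g := by
  let j : cokernel (K.d (i + 2) (i + 1)) ⟶ K.X i := cokernel.desc _ (K.d (i + 1) i) (K.d_comp_d _ _ _)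
  have hj : cokernel.π (K.d (i + 2) (i + 1)) ≫ j = K.d (i + 1) i := cokernel.π_desc _ _ _
  have hl : ∀ (T : A) (g : cokernel (K.d (i + 2) (i + 1)) ⟶ T), M T → ∃ h, j ≫ h = g := by
    intro T g hT
    obtain ⟨h, hh⟩ := (hK.2 T hT).2 i hi (cokernel.π _ ≫ g) (by rw [cokernel.condition_assoc, zero_comp])
    exact ⟨h, by rw [← cancel_epi (cokernel.π (K.d (i + 2) (i + 1))), reassoc_of% hj, hh]⟩
  obtain ⟨N, m, hN, hm⟩ := hM (cokernel (K.d (i + 2) (i + 1)))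
  obtain ⟨h, rfl⟩ := hl N m hN
  -- A monomorphism into an object of M factors through `j`.
  exact ⟨j, hj, mono_of_mono j h, hl⟩

lemma Cores.of_iso {P : ObjectProperty A} {k : ℕ} {X Y : A} (h : Cores M P k X) (e : X ≅ Y) :
    Cores M P k Y := by
  cases k with
  | zero => exact IsZero.of_iso h e.symm
  | succ k =>
    obtain ⟨V, C, i, p, hS, hV, hi, hC⟩ := h
    refine ⟨V, C, e.inv ≫ i, p, hS.of_iso e (Iso.refl _) (Iso.refl _) (by simp) (by simp), hV,
      fun T g hT => ?_, hC⟩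
    obtain ⟨h, hh⟩ := hi T (e.hom ≫ g) hT
    exact ⟨h, by simp [hh]⟩

lemma IsRightDExact.cores {U : ObjectProperty A} (hM : ∀ X, ∃ (N : A) (i : X ⟶ N), M N ∧ Mono i)
    (hK : IsRightDExact d M K) (hU : ∀ i, i < d → U (K.X i)) {i : ℕ} (hi : i < d) :
    Cores M U (i + 1) (cokernel (K.d (i + 2) (i + 1))) := by
  obtain ⟨j, hj, hj', hl⟩ := hK.exists_ses hM hi
  refine ⟨K.X i, cokernel j, j, cokernel.π j, SES.of_mono j, hU i hi, hl, ?_⟩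
  induction i with
  | zero =>
    obtain ⟨N, m, hN, hm⟩ := hM (cokernel j)
    -- Exactness at Hom(K 0, T) kills the map from K 0 to an object of M in which the last cokernel
    -- embeds, so that cokernel is zero.
    have h₀ : cokernel.π j ≫ m = 0 := (hK.2 N hN).1 _ (by
      rw [← hj, Category.assoc, cokernel.condition_assoc, zero_comp, comp_zero])
    have : cokernel.π j = 0 := by rw [← cancel_mono m, h₀, zero_comp]
    refine (IsZero.iff_id_eq_zero _).2 ?_
    rw [← cancel_epi (cokernel.π j), this, zero_comp, zero_comp]
  | succ i ih =>
    obtain ⟨j', hj₁, hj₂, hl'⟩ := hK.exists_ses hM (show i < d by omega)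
    have H : Cores M U (i + 1) (cokernel (K.d (i + 2) (i + 1))) :=
      ⟨K.X i, cokernel j', j', cokernel.π j', SES.of_mono j', hU i (by omega), hl',
        ih (by omega) j' hj₁ hj₂ hl'⟩
    exact H.of_iso (cokernelIsoOfEq hj.symm ≪≫ cokernelEpiComp _ _)

end Coresolution

section

variable {d : ℕ} {M U : ObjectProperty A}

/-- The kernel L of V → X need not lie in M. Covering it by an object N of M leaves the cokernel
unchanged, so the d-cokernel of N → V coresolves X. -/
lemma IsTorsionClass.cores (hd : 1 ≤ d) (hM : IsClusterTilting d ⊤ M) (hU : IsTorsionClass d M U)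
    {X : A} (hX : Pres U 1 X) : Cores M U d X := by
  obtain ⟨d, rfl⟩ := Nat.exists_eq_add_of_le' hd
  obtain ⟨L, V, i, p, hS, hV, -⟩ := hX
  obtain ⟨N, q, hN, Q, l, w, hq⟩ := hM.generating L trivial
  have := hq.1.epi_g
  have : Epi q := this
  have hcog : ∀ X, ∃ (N : A) (i : X ⟶ N), M N ∧ Mono i := fun X => by
    obtain ⟨N, i, hN, Q, l, w, hq⟩ := hM.cogenerating X trivial
    exact ⟨N, i, hN, hq.1.mono_f⟩
  obtain ⟨K, hK, ⟨e⟩, hKU⟩ := hU.dQuotients N V (q ≫ i) hN hV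
  have hX := hS.epi
  let e₁ : cokernel (K.d (d + 2) (d + 1)) ≅ cokernel (q ≫ i) :=
    cokernel.mapIso _ _ (Arrow.leftFunc.mapIso e) (Arrow.rightFunc.mapIso e) e.hom.w.symm
  let e₂ : cokernel i ≅ X := IsColimit.coconePointUniqueUpToIso (cokernelIsCokernel i) hS.2.gIsCokernel
  exact (hK.cores hcog hKU (Nat.lt_succ_self d)).of_iso (e₁ ≪≫ cokernelEpiComp q i ≪≫ e₂)

variable [HasExt.{w} A]

/-- Represent γ by a sequence with middle terms in U and take its last map W → K. Rigidity against
the other middle terms lets the later connecting classes be cancelled, so γ kills a map from M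
exactly when the first conflation does. -/
lemma IsTorsionClass.exists_extension (hd : 1 ≤ d) (hR : Rigid.{w} d M M)
    (hU : IsTorsionClass d M U) {K V : A} (hK : U K) (hV : U V) (γ : Ext.{w} K V d) :
    ∃ (Y W : A) (i : Y ⟶ W) (p : W ⟶ K), SES i p ∧ U W ∧ Res U d Y ∧
      ∀ (N : A) (g : N ⟶ K), M N →
        ((Ext.mk₀ g).comp γ (zero_add d) = 0 ↔ ∃ l, l ≫ p = g) := by
  have := hU.summands
  obtain ⟨d, rfl⟩ := Nat.exists_eq_add_of_le' hd
  obtain ⟨ξ, hξ⟩ := NExtension.exists_of_class (E := (⊤ : ObjectProperty A)) (fun _ _ => trivial)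
    (Y := V) trivial (n := d) (fun i hi _ => by
      obtain ⟨i, rfl⟩ := Nat.exists_eq_add_of_le' hi
      exact effaceable_top i V) (X := K) trivial γ
  obtain ⟨ζ, hζU, hζ⟩ := hU.dExtensions K V hK hV ξ
  obtain ⟨γ', hγ'⟩ := ζ.exists_hasClass
  obtain rfl := hξ.eq_of_yonedaEquiv hγ' hζ
  obtain ⟨D, b, hb, hγ⟩ := hγ'
  have := D.isIso
  have := ζ.isIso_p D
  have hb' : b = inv (D.p (d + 1)) ≫ ζ.left.hom := by simp [← hb]
  have : IsIso b := by rw [hb']; infer_instance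
  -- The left end V, in degree d + 2, also lies in U; it is the last of the d + 1 terms resolving
  -- the kernel of W → K.
  have hζU' : ∀ i, 1 ≤ i → i ≤ d + 2 → U (ζ.K.X i) := fun i hi hi' => by
    rcases hi'.lt_or_eq with h | rfl
    · exact hζU i hi (by omega)
    · exact U.prop_of_iso ζ.left.symm hV
  let t := D.j 0 ≫ ζ.right.hom
  have hγt : ∀ {N : A} (g : N ⟶ D.Z 0), (Ext.mk₀ (g ≫ t)).comp γ (zero_add _) = 0 ↔
      (Ext.mk₀ g).comp (D.cls (d + 1) : Ext.{w} _ _ _) (zero_add _) = 0 := fun {N} g => by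
    rw [← Ext.mk₀_comp_mk₀_assoc, hγ, ← Ext.comp_assoc_of_third_deg_zero]
    refine ⟨fun h => ?_, fun h => by rw [h, Ext.zero_comp]⟩
    have := congrArg (fun z => z.comp (Ext.mk₀ (inv b)) (add_zero _)) h
    simpa [Ext.comp_assoc_of_third_deg_zero] using this
  refine ⟨D.Z 1, ζ.K.X 1, D.j 1, D.p 0 ≫ t,
    (D.ses 0).of_iso (Iso.refl _) (Iso.refl _) (asIso t) (by simp) (by simp), hζU 1 le_rfl (by omega),
    D.res (n := d + 2) (ζ.isZero _ (by omega)) (by omega) fun i hi hi' => hζU' i (by omega) hi',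
    fun N g hN => ⟨fun h => ?_, ?_⟩⟩
  · have hg : g = (g ≫ inv t) ≫ t := by simp
    rw [hg, hγt] at h
    have key : ∀ k, k ≤ d → (Ext.mk₀ (g ≫ inv t)).comp (D.cls (k + 1) : Ext.{w} _ _ _)
        (zero_add _) = 0 → (Ext.mk₀ (g ≫ inv t)).comp (D.ses 0).cls (zero_add 1) = 0 := by
      intro k
      induction k with
      | zero =>
        intro _ h
        rwa [AcyclicData.cls_succ, AcyclicData.cls_zero, Ext.mk₀_id_comp] at h
      | succ k ih =>
        intro hk h
        apply ih (by omega)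
        rw [AcyclicData.cls_succ, ← Ext.comp_assoc (a₁₂ := k + 1) _ _ _ (by omega) rfl (by omega)] at h
        obtain ⟨y, hy⟩ := (D.ses (k + 1)).cov₃ _ _ h
        rw [← hy, hR N _ hN (hU.le _ (hζU (k + 2) (by omega) (by omega))) (k + 1) (by omega)
          (by omega) y, Ext.zero_comp]
    obtain ⟨l, hl⟩ := ((D.ses 0).exists_lift_iff _).2 (key d le_rfl h)
    exact ⟨l, by rw [reassoc_of% hl]; simp⟩
  · rintro ⟨l, rfl⟩
    rw [← Ext.mk₀_comp_mk₀_assoc, (hγt _).2 (D.comp_cls_eq_zero d), Ext.comp_zero]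

lemma IsTorsionClass.torsionSetup (hd : 1 ≤ d) (hM : IsClusterTilting d ⊤ M)
    (hU : IsTorsionClass d M U) : TorsionSetup.{w} d M U := by
  have := hU.finiteSums
  have := hU.summands
  have hR : Rigid.{w} d M M := fun N V hN hV i hi hid =>
    (extVanishes_top_iff i hi N V).1 (((hM.mem_iff_left N).1 hN).2 i hi hid V hV)
  exact
  { pos := hd
    le := hU.le
    zero := by
      obtain ⟨O, hO, hO'⟩ := U.exists_prop_of_containsZero
      exact ⟨O, hO, hO'⟩
    biprod := fun X Y hX hY => U.prop_of_iso (biprod.isoProd X Y).symm (U.prop_prod X Y hX hY)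
    retract := fun s p hsp hY => U.prop_of_retract ⟨s, p, hsp⟩ hY
    rigid := hR
    mem := fun X hX => (hM.mem_iff_right X).2 ⟨trivial, fun i hi hid N hN =>
      (extVanishes_top_iff.{w} i hi N X).2 (hX N hN i hi hid)⟩
    cover := fun X => by
      obtain ⟨N, p, hN, K, i, w, hp⟩ := hM.generating X trivial
      obtain ⟨N', f, hN', hf⟩ := hM.contravariantlyFinite X trivial
      obtain ⟨g, hg⟩ := hf N p hN
      -- An epimorphism from M factors through the approximation, so the approximation is itself
      -- epi.
      have : Epi (g ≫ f) := by rw [hg]; exact hp.1.epi_g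
      exact ⟨N', f, hN', epi_of_epi g f, hf⟩
    cores := fun X hX => hU.cores hd hM hX
    extension := fun K V hK hV γ => hU.exists_extension hd hR hK hV γ }

end

end HigherTorsion

theorem theorem4p9 {A : Type u} [Category.{v} A] [Abelian A] (d : ℕ) (hd : 1 ≤ d)
    (M U : ObjectProperty A)
    (hM : HigherTorsion.IsClusterTilting d ⊤ M)
    (hU : HigherTorsion.IsTorsionClass d M U) :
    (HigherTorsion.resolved d ⊤ U).IsClosedUnderExtensions ∧
      HigherTorsion.IsClusterTilting d (HigherTorsion.resolved d ⊤ U) U := by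
  have : HasExt.{max u v} A := HasExt.standard A
  have h : HigherTorsion.TorsionSetup.{max u v} d M U := hU.torsionSetup hd hM
  rw [HigherTorsion.resolved_eq_res]
  exact ⟨h.isClosedUnderExtensions, h.isClusterTilting⟩
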